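/- Let $c\in\mathbb{C}\setminus\{0\}$ and put $g(x,y)=\frac{c}{x-y}$, $f(x,y)=1+g(x,y)$, $h(x,y)=\frac{x-y+c}{c}$. Put $[1]=[2]=0$, $[3]=1$. Let $\mathcal A$ be an associative unital $\mathbb{C}$-algebra with elements $T_{ij}(u)$ ($1\le i,j\le 3$, $u\in\mathbb{C}$) satisfying the $\mathfrak{gl}(2|1)$ RTT relations: for all $u\neq v$ and all $i,j,k,l$, $$T_{ij}(u)T_{kl}(v)-(-1)^{([i]+[j])([k]+[l])}T_{kl}(v)T_{ij}(u)=(-1)^{[i]([k]+[l])+[k][l]}\,g(u,v)\bigl(T_{kj}(v)T_{il}(u)-T_{kj}(u)T_{il}(v)\bigr).$$ For finite families of variables, write $f(\bar x,\bar y)=\prod_{j,k}f(x_j,y_k)$, and similarly for $g$ and $h$; for $(i,j)\in\{(1,2),(2,2)\}$ let $T_{ij}(\bar u)=\prod_k T_{ij}(u_k)$; for $j=1,2$ let $$\mathbb{T}_{j3}(v_1,\dots,v_n)=\frac{T_{j3}(v_1)\cdots T_{j3}(v_n)}{\prod_{n\ge \ell>m\ge1}h(v_\ell,v_m)}.$$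 In these products the elements of every subfamily are taken in increasing order of their subscripts. For $\#\bar x=\#\bar y=n$ let $$K(\bar x|\bar y)=\prod_{j<k}g(x_j,x_k)\prod_{j>k}g(y_j,y_k)\;h(\bar x,\bar y)\;\det_{1\le j,k\le n}\left(\frac{g(x_j,y_k)}{h(x_j,y_k)}\right),\qquad K(\emptyset|\emptyset)=1.$$ For $\#\bar u=a$ and $\#\bar v=b$ define $$Y_{a,b}(\bar u,\bar v)=\sum K(\bar v_\alpha|\bar u_\alpha)\,f(\bar u_\alpha,\bar u_{\bar\alpha})\,g(\bar v_{\bar\alpha},\bar v_\alpha)\;\mathbb{T}_{13}(\bar v_\alpha)\,\mathbb{T}_{23}(\bar v_{\bar\alpha})\,T_{12}(\bar u_{\bar\alpha})\,T_{22}(\bar u_\alpha),$$ where the sum is over all partitions of $\bar u$ into disjoint subsets $\bar u_\alpha,\bar u_{\bar\alpha}$ and of $\bar v$ into disjoint subsets $\bar v_\alpha,\bar v_{\bar\alpha}$ with $\#\bar u_\alpha=\#\bar v_\alpha$. Let $a\ge1$, $b\ge0$, and let $\bar u=\{u_1,\dots,u_a\}$, $\bar v=\{v_1,\dots,v_b\}$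 be complex numbers such that $u_1,\dots,u_a,v_1,\dots,v_b$ are pairwise distinct, $h(v_j,v_k)\ne0$ for $j\ne k$, and $h(v_j,u_i)\neq0$ for all $i,j$. Write $\bar u_a=\bar u\setminus\{u_a\}$. Then $$Y_{a,b}(\bar u,\bar v)=T_{12}(u_a)\,Y_{a-1,b}(\bar u_a,\bar v)+\sum g(\bar v_\rho,u_a)\,f(\bar v_\rho,\bar u_a)\,g(\bar v_{\bar\rho},\bar v_\rho)\;T_{13}(u_a)\,Y_{a-1,b-1}(\bar u_a,\bar v_{\bar\rho})\,T_{22}(\bar v_\rho),$$ where the sum is over partitions of $\bar v$ into $\bar v_\rho$ and $\bar v_{\bar\rho}$ with $\#\bar v_\rho=1$ (an empty sum if $b=0$). -/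

import Mathlib

namespace GL21

open Finset

noncomputable section

/-- `g(x,y) = c / (x - y)`. -/
def g (c x y : ℂ) : ℂ := c / (x - y)

/-- `f(x,y) = 1 + g(x,y)`. -/
def f (c x y : ℂ) : ℂ := 1 + g c x y

/-- `h(x,y) = (x - y + c) / c`, which is `f(x,y) / g(x,y)` for `x ≠ y`, `c ≠ 0`. -/
def h (c x y : ℂ) : ℂ := (x - y + c) / c

/-- The parity of the basis vectors of `ℂ^{2|1}`. The usual indices `1, 2, 3` are written `0, 1, 2 : Fin 3`. -/
def parity (i : Fin 3) : ℕ := if i = 2 then 1 else 0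

/-- The entries `T i j u` of the monodromy matrix satisfy the commutation relations of the
`gl(2|1)` graded RTT algebra, for all spectral parameters `x ≠ y`. -/
def IsRTT {A : Type*} [Ring A] [Algebra ℂ A] (c : ℂ) (T : Fin 3 → Fin 3 → ℂ → A) : Prop :=
  ∀ (i j k l : Fin 3) (x y : ℂ), x ≠ y →
    T i j x * T k l y
        - ((-1 : ℂ) ^ ((parity i + parity j) * (parity k + parity l))) • (T k l y * T i j x) =
      ((-1 : ℂ) ^ (parity i * (parity k + parity l) + parity k * parity l) * g c x y) •
        (T k j y * T i l x - T k j x * T i l y)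

/-- The domain wall partition function `K(x|y)` of two `n`-tuples (equal to `1` for `n = 0`). -/
def K (c : ℂ) {n : ℕ} (x y : Fin n → ℂ) : ℂ :=
  (∏ j : Fin n, ∏ k ∈ univ.filter (fun k => j < k), g c (x j) (x k)) *
    (∏ j : Fin n, ∏ k ∈ univ.filter (fun k => k < j), g c (y j) (y k)) *
    (∏ j : Fin n, ∏ k : Fin n, h c (x j) (y k)) *
    (Matrix.of fun j k : Fin n => g c (x j) (y k) / h c (x j) (y k)).det

section Operators

variable {A : Type*} [Ring A] [Algebra ℂ A] {ι κ : Type*} [LinearOrder ι] [LinearOrder κ]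

/-- `O(w_s)`: the product of the operators `O (w k)`, `k ∈ s`, in increasing order of `k`. -/
def opProd (O : ℂ → A) (w : ι → ℂ) (s : Finset ι) : A :=
  ((s.sort (· ≤ ·)).map fun k => O (w k)).prod

/-- The symmetric product of the odd operators `O (w k)`, `k ∈ s` (used with `O = T_{j3}`):
the naturally ordered product divided by `∏_{ℓ > m} h(w_ℓ, w_m)`. -/
def symProd (c : ℂ) (O : ℂ → A) (w : ι → ℂ) (s : Finset ι) : A :=
  (∏ l ∈ s, ∏ m ∈ s.filter (fun m => m < l), h c (w l) (w m))⁻¹ • opProd O w s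

/-- The operator `Y_{a,b}(ū_I, v̄_J)`, `a = #I`, `b = #J`, for the sets of variables
`ū_I = {u_i}_{i ∈ I}` and `v̄_J = {v_j}_{j ∈ J}`. The sum runs over the partitions of `ū_I` into
`ū_α` and `ū_{I \ α}` and of `v̄_J` into `v̄_β` and `v̄_{J \ β}` with `#α = #β`. -/
def Y (c : ℂ) (T : Fin 3 → Fin 3 → ℂ → A) (u : ι → ℂ) (v : κ → ℂ)
    (I : Finset ι) (J : Finset κ) : A :=
  ∑ α ∈ I.powerset, ∑ β ∈ J.powerset,
    if hc : #β = #α then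
      (K c (fun i => v (β.orderEmbOfFin hc i)) (fun i => u (α.orderEmbOfFin rfl i)) *
        (∏ i ∈ α, ∏ i' ∈ I \ α, f c (u i) (u i')) *
        (∏ j ∈ J \ β, ∏ j' ∈ β, g c (v j) (v j'))) •
        (symProd c (T 0 2) v β * symProd c (T 1 2) v (J \ β) *
          opProd (T 0 1) u (I \ α) * opProd (T 1 1) u α)
    else 0

end Operators

end

end GL21

namespace GL21

open Finset

noncomputable section

/-! ### Partial fractions for products of `g` and `f` -/

section Scalars

/-! The recursion in `u` is an action formula in disguise: it says what `T_{12}(z)`, with `z = u_a`,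
does to the vector built on the remaining variables. The explicit sum for `Y` is awkward for
computing such an action, so `Y` is first shown to obey a recursion in `v`, and the action is then
proved by induction along that recursion.

Recursion in `v` (`Y_insert_min`). In `Y` either `v_j` sits among the `T_{23}` or among the
`T_{13}`. Terms of the first kind are reproduced when `T_{23}(v_j)` passes the `T_{13}`-product of
the smaller `Y` without exchanging its argument. Every other term starts with `T_{13}(v_j)`, and its
coefficients agree by a partial fraction expansion of `f(v_γ, v_j) K(v_j, v_β | u_α)`
(`prod_f_mul_KSet_insert`). That expansion rests on `K_succ`: as a function of its first variable,
`K` has poles only at the `y_k`, because the residues at the other `x_j` add up to a determinant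
with two equal rows.

Action (`act_offShell`). Up to the factor `symNorm`, `Y` is therefore the vector `offShell` obtained
by repeated use of `addVar`. Commuting `T_{12}(z)` past `T_{23}(x)` creates `T_{22}`, and commuting
`T_{22}(z)` past `T_{13}(x)` creates `T_{12}`, so the two actions have to be proved together. The
induction closes because their unwanted terms are `T_{13}(z) Z` and `T_{23}(z) Z` with one common
`Z`, whose recursion `addVarUnwanted` is solved by the explicit sum `unwanted`. Taking `z = u_a` and
dividing by `symNorm` gives the theorem. -/

theorem g_swap (c x y : ℂ) : g c y x = -g c x y := by
  unfold g
  rw [← neg_sub x y, div_neg]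

theorem f_eq_g_mul_h {c x y : ℂ} (hc : c ≠ 0) (hxy : x ≠ y) : f c x y = g c x y * h c x y := by
  have : x - y ≠ 0 := sub_ne_zero.2 hxy
  unfold f h g
  field_simp

theorem g_ne_zero {c x y : ℂ} (hc : c ≠ 0) (hxy : x ≠ y) : g c x y ≠ 0 :=
  div_ne_zero hc (sub_ne_zero.2 hxy)

/-- Partial fraction expansion of a polynomial divided by a product of linear factors. -/
theorem prod_g_mul_eval {σ : Type*} [DecidableEq σ] (c : ℂ) (s : Finset σ) (t : σ → ℂ)
    (ht : Set.InjOn t s) (P : Polynomial ℂ) (hP : P.degree < #s) (x : ℂ)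
    (hx : ∀ i ∈ s, x ≠ t i) :
    (∏ i ∈ s, g c x (t i)) * P.eval x =
      ∑ i ∈ s, g c x (t i) * P.eval (t i) * ∏ l ∈ s.erase i, g c (t i) (t l) := by
  have h1 := Lagrange.eq_interpolate ht hP
  have h2 : P.eval x = (∏ i ∈ s, (x - t i)) *
      ∑ i ∈ s, Lagrange.nodalWeight s t i * (x - t i)⁻¹ * P.eval (t i) := by
    conv_lhs => rw [h1]
    rw [Lagrange.eval_interpolate_not_at_node _ hx, Lagrange.eval_nodal]
  have h3 : (∏ i ∈ s, g c x (t i)) * (∏ i ∈ s, (x - t i)) = c ^ #s := by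
    rw [← prod_mul_distrib, ← prod_const]
    refine prod_congr rfl fun i hi => ?_
    have := sub_ne_zero.2 (hx i hi)
    unfold g
    field_simp
  rw [h2, ← mul_assoc, h3, mul_sum]
  refine sum_congr rfl fun i hi => ?_
  have h4 : ∏ l ∈ s.erase i, g c (t i) (t l) = c ^ (#s - 1) * Lagrange.nodalWeight s t i := by
    rw [Lagrange.nodalWeight, ← card_erase_of_mem hi, ← prod_const, ← prod_mul_distrib]
    exact prod_congr rfl fun l _ => by rw [g, div_eq_mul_inv]
  have h5 : c ^ #s = c * c ^ (#s - 1) := by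
    rw [← pow_succ', Nat.sub_add_cancel (card_pos.2 ⟨i, hi⟩)]
  rw [h4, h5, g, div_eq_mul_inv]
  ring

/-- Partial fraction expansion in `x` of `f(t̄,x) g(x,y)`. -/
theorem prod_f_mul_g {σ : Type*} [DecidableEq σ] (c : ℂ) (s : Finset σ) (t : σ → ℂ)
    (ht : Set.InjOn t s) (x y : ℂ) (hxy : x ≠ y) (hx : ∀ i ∈ s, t i ≠ x) (hy : ∀ i ∈ s, t i ≠ y) :
    (∏ i ∈ s, f c (t i) x) * g c x y = (∏ i ∈ s, f c (t i) y) * g c x y +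
      ∑ k ∈ s, g c (t k) x * (∏ i ∈ s.erase k, f c (t i) (t k)) * g c (t k) y := by
  induction s using Finset.induction_on generalizing x with
  | empty => simp
  | insert p s hp ih =>
    have hts : Set.InjOn t s := ht.mono (by simp)
    have hpx := hx p (mem_insert_self _ _)
    have hpy := hy p (mem_insert_self _ _)
    have hk : ∀ k ∈ s, t k ≠ t p := fun k hk e =>
      hp (ht (mem_insert_of_mem hk) (mem_insert_self _ _) e ▸ hk)
    have ih1 := ih hts x hxy (fun i hi => hx i (mem_insert_of_mem hi))
      (fun i hi => hy i (mem_insert_of_mem hi))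
    -- Multiplying by the new factor `f(t_p, x)` produces products of poles at `t_k` and `t_p`. Once
    -- these are separated by `e2`, the residue at `t_p` is the expansion for `s` evaluated at `x =
    -- t_p`.
    have ih2 := ih hts (t p) hpy hk (fun i hi => hy i (mem_insert_of_mem hi))
    have e1 : f c (t p) x * g c x y = f c (t p) y * g c x y + g c (t p) x * g c (t p) y := by
      have := sub_ne_zero.2 hpx
      have := sub_ne_zero.2 hpy
      have := sub_ne_zero.2 hxy
      unfold f g
      field_simp
      ring
    have e2 : ∀ k ∈ s, f c (t p) x * g c (t k) x =
        f c (t p) (t k) * g c (t k) x + g c (t p) x * g c (t k) (t p) := by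
      intro k hks
      have := sub_ne_zero.2 hpx
      have := sub_ne_zero.2 (hx k (mem_insert_of_mem hks))
      have := sub_ne_zero.2 (hk k hks)
      have := sub_ne_zero.2 (hk k hks).symm
      rw [g_swap c (t p) (t k)]
      unfold f g
      field_simp
      ring
    rw [prod_insert hp, prod_insert hp, sum_insert hp, erase_insert hp]
    have e3 : ∑ k ∈ s, g c (t k) x * (∏ i ∈ (insert p s).erase k, f c (t i) (t k)) * g c (t k) y =
        ∑ k ∈ s, (f c (t p) x * (g c (t k) x * (∏ i ∈ s.erase k, f c (t i) (t k)) * g c (t k) y) -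
          g c (t p) x *
            (g c (t k) (t p) * (∏ i ∈ s.erase k, f c (t i) (t k)) * g c (t k) y)) := by
      refine sum_congr rfl fun k hks => ?_
      have hpk : p ≠ k := fun e => hp (e ▸ hks)
      rw [erase_insert_of_ne hpk, prod_insert (fun hm => hp (mem_of_mem_erase hm))]
      linear_combination (-(∏ i ∈ s.erase k, f c (t i) (t k)) * g c (t k) y) * e2 k hks
    rw [e3, sum_sub_distrib, ← mul_sum, ← mul_sum]
    linear_combination f c (t p) x * ih1 + (∏ i ∈ s, f c (t i) y) * e1 - g c (t p) x * ih2

end Scalars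

/-! ### Symmetry of the domain wall partition function and its expansion in one variable -/

section Izergin

/-- Behind the triangular product is an inverse Vandermonde determinant, which makes its sign under
permutations the sign of a row permutation. -/
theorem prod_g_eq_vandermonde (c : ℂ) {n : ℕ} (x : Fin n → ℂ) :
    (∏ j : Fin n, ∏ k ∈ univ.filter (fun k => j < k), g c (x j) (x k)) =
      (∏ j : Fin n, ∏ _k ∈ univ.filter (fun k => j < k), (-c)) / (Matrix.vandermonde x).det := by
  rw [Matrix.det_vandermonde, ← prod_div_distrib]
  refine prod_congr rfl fun j _ => ?_
  have : Ioi j = univ.filter (fun k => j < k) := by ext; simp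
  rw [this, ← prod_div_distrib]
  refine prod_congr rfl fun k _ => ?_
  rw [g, ← neg_sub (x k), div_neg, neg_div]

theorem prod_g_swap_eq_vandermonde (c : ℂ) {n : ℕ} (y : Fin n → ℂ) :
    (∏ j : Fin n, ∏ k ∈ univ.filter (fun k => k < j), g c (y j) (y k)) =
      (∏ j : Fin n, ∏ _k ∈ univ.filter (fun k => j < k), c) / (Matrix.vandermonde y).det := by
  rw [Matrix.det_vandermonde, ← prod_div_distrib,
    prod_comm' (t' := univ) (s' := fun k => univ.filter (fun j => k < j)) (by simp)]
  refine prod_congr rfl fun j _ => ?_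
  have : Ioi j = univ.filter (fun k => j < k) := by ext; simp
  rw [this, ← prod_div_distrib]
  rfl

theorem det_vandermonde_comp_perm {n : ℕ} (x : Fin n → ℂ) (σ : Equiv.Perm (Fin n)) :
    (Matrix.vandermonde (x ∘ σ)).det = (σ.sign : ℂ) * (Matrix.vandermonde x).det := by
  rw [← Matrix.det_permute]
  rfl

theorem sign_mul_self {n : ℕ} (σ : Equiv.Perm (Fin n)) : ((σ.sign : ℤ) : ℂ) * (σ.sign : ℤ) = 1 := by
  exact_mod_cast Int.units_coe_mul_self _

theorem div_sign_mul {n : ℕ} (σ : Equiv.Perm (Fin n)) (a d : ℂ) :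
    a / (((σ.sign : ℤ) : ℂ) * d) = ((σ.sign : ℤ) : ℂ) * (a / d) := by
  rw [div_mul_eq_div_div, div_eq_mul_inv a, inv_eq_of_mul_eq_one_left (sign_mul_self σ)]
  ring

theorem prod_g_comp_perm (c : ℂ) {n : ℕ} (x : Fin n → ℂ) (σ : Equiv.Perm (Fin n)) :
    (∏ j : Fin n, ∏ k ∈ univ.filter (fun k => j < k), g c ((x ∘ σ) j) ((x ∘ σ) k)) =
      (σ.sign : ℂ) * ∏ j : Fin n, ∏ k ∈ univ.filter (fun k => j < k), g c (x j) (x k) := by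
  rw [prod_g_eq_vandermonde, prod_g_eq_vandermonde, det_vandermonde_comp_perm, div_sign_mul]

theorem prod_g_swap_comp_perm (c : ℂ) {n : ℕ} (x : Fin n → ℂ) (σ : Equiv.Perm (Fin n)) :
    (∏ j : Fin n, ∏ k ∈ univ.filter (fun k => k < j), g c ((x ∘ σ) j) ((x ∘ σ) k)) =
      (σ.sign : ℂ) * ∏ j : Fin n, ∏ k ∈ univ.filter (fun k => k < j), g c (x j) (x k) := by
  rw [prod_g_swap_eq_vandermonde, prod_g_swap_eq_vandermonde, det_vandermonde_comp_perm,
    div_sign_mul]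

/-- The sign of the permutation arises twice, from the triangular prefactor and from the rows of the
determinant, and squares to one. -/
theorem K_comp_perm_left (c : ℂ) {n : ℕ} (x y : Fin n → ℂ) (σ : Equiv.Perm (Fin n)) :
    K c (x ∘ σ) y = K c x y := by
  have h1 : (∏ j : Fin n, ∏ k : Fin n, h c ((x ∘ σ) j) (y k)) =
      ∏ j : Fin n, ∏ k : Fin n, h c (x j) (y k) :=
    Equiv.prod_comp σ fun j => ∏ k : Fin n, h c (x j) (y k)
  have h2 : (Matrix.of fun j k : Fin n => g c ((x ∘ σ) j) (y k) / h c ((x ∘ σ) j) (y k)).det =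
      (σ.sign : ℂ) * (Matrix.of fun j k : Fin n => g c (x j) (y k) / h c (x j) (y k)).det := by
    rw [← Matrix.det_permute]
    rfl
  rw [K, K, h1, h2, prod_g_comp_perm]
  linear_combination (∏ j : Fin n, ∏ k ∈ univ.filter (fun k => j < k), g c (x j) (x k)) *
    (∏ j : Fin n, ∏ k ∈ univ.filter (fun k => k < j), g c (y j) (y k)) *
    (∏ j : Fin n, ∏ k : Fin n, h c (x j) (y k)) *
    (Matrix.of fun j k : Fin n => g c (x j) (y k) / h c (x j) (y k)).det * sign_mul_self σ

theorem K_comp_perm_right (c : ℂ) {n : ℕ} (x y : Fin n → ℂ) (σ : Equiv.Perm (Fin n)) :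
    K c x (y ∘ σ) = K c x y := by
  have h1 : (∏ j : Fin n, ∏ k : Fin n, h c (x j) ((y ∘ σ) k)) =
      ∏ j : Fin n, ∏ k : Fin n, h c (x j) (y k) :=
    prod_congr rfl fun j _ => Equiv.prod_comp σ fun k => h c (x j) (y k)
  have h2 : (Matrix.of fun j k : Fin n => g c (x j) ((y ∘ σ) k) / h c (x j) ((y ∘ σ) k)).det =
      (σ.sign : ℂ) * (Matrix.of fun j k : Fin n => g c (x j) (y k) / h c (x j) (y k)).det := by
    rw [← Matrix.det_permute']
    rfl
  rw [K, K, h1, h2, prod_g_swap_comp_perm]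
  linear_combination (∏ j : Fin n, ∏ k ∈ univ.filter (fun k => j < k), g c (x j) (x k)) *
    (∏ j : Fin n, ∏ k ∈ univ.filter (fun k => k < j), g c (y j) (y k)) *
    (∏ j : Fin n, ∏ k : Fin n, h c (x j) (y k)) *
    (Matrix.of fun j k : Fin n => g c (x j) (y k) / h c (x j) (y k)).det * sign_mul_self σ

theorem prod_g_succ (c : ℂ) {n : ℕ} (x : Fin (n + 1) → ℂ) :
    (∏ j : Fin (n + 1), ∏ k ∈ univ.filter (fun k => j < k), g c (x j) (x k)) =
      (∏ j : Fin n, g c (x 0) (x j.succ)) *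
        ∏ j : Fin n, ∏ k ∈ univ.filter (fun k => j < k), g c (x j.succ) (x k.succ) := by
  simp only [prod_filter]
  rw [Fin.prod_univ_succ]
  simp [Fin.prod_univ_succ]

/-- The inverse of the cycle `k.cycleRange` brings `y_k` to the front and keeps the order of the
others. Its sign `(-1)^k` is the one that appears in the Laplace expansion. -/
theorem prod_g_swap_succAbove (c : ℂ) {n : ℕ} (y : Fin (n + 1) → ℂ) (k : Fin (n + 1)) :
    (-1) ^ (k : ℕ) * (∏ j : Fin (n + 1), ∏ k ∈ univ.filter (fun k => k < j), g c (y j) (y k)) =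
      (∏ j : Fin n, g c (y (k.succAbove j)) (y k)) *
        ∏ j : Fin n, ∏ l ∈ univ.filter (fun l => l < j),
          g c (y (k.succAbove j)) (y (k.succAbove l)) := by
  have h1 := prod_g_swap_comp_perm c y k.cycleRange.symm
  rw [Equiv.Perm.sign_symm, Fin.sign_cycleRange] at h1
  push_cast at h1
  rw [← h1]
  simp only [prod_filter]
  rw [Fin.prod_univ_succ]
  simp [Fin.prod_univ_succ, Fin.cycleRange_symm_succ, Fin.cycleRange_symm_zero, prod_mul_distrib]

/-- The determinant with a repeated row vanishes. -/
theorem sum_minor_eq_zero {n : ℕ} (M : Fin n → Fin (n + 1) → ℂ) (j : Fin n) :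
    ∑ k : Fin (n + 1), (-1) ^ (k : ℕ) * M j k *
      (Matrix.of fun i l : Fin n => M i (k.succAbove l)).det = 0 := by
  have h1 : (Matrix.of (Fin.cons (M j) M : Fin (n + 1) → Fin (n + 1) → ℂ)).det = 0 :=
    Matrix.det_zero_of_row_eq (i := 0) (j := j.succ) (Fin.succ_ne_zero j).symm (by
      ext; simp)
  rw [Matrix.det_succ_row_zero] at h1
  exact h1

/-- This is the vanishing determinant with row `j` repeated, cleared of the denominators of that
row. It removes the poles at `x_0 = x_j` in `K_succ`. -/
theorem sum_minor_mul_prod_h (c : ℂ) {n : ℕ} (x : Fin n → ℂ) (y : Fin (n + 1) → ℂ)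
    (hh : ∀ j k, h c (x j) (y k) ≠ 0) (j : Fin n) :
    ∑ k : Fin (n + 1), (-1) ^ (k : ℕ) *
      (Matrix.of fun i l : Fin n =>
        g c (x i) (y (k.succAbove l)) / h c (x i) (y (k.succAbove l))).det *
      (g c (x j) (y k) * ∏ l : Fin n, h c (x j) (y (k.succAbove l))) = 0 := by
  have h1 := congrArg (fun t => (∏ l, h c (x j) (y l)) * t)
    (sum_minor_eq_zero (fun i k => g c (x i) (y k) / h c (x i) (y k)) j)
  simp only [mul_zero, mul_sum] at h1
  rw [← h1]
  refine sum_congr rfl fun k _ => ?_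
  rw [Fin.prod_univ_succAbove _ k]
  have := hh j k
  field_simp

/-- Partial fraction expansion of one term of the determinant. -/
theorem prod_h_partial_fraction (c : ℂ) (hc : c ≠ 0) {n : ℕ} (x z : ℂ) (t w : Fin n → ℂ)
    (ht : Function.Injective t) (hx : ∀ i, x ≠ t i) (hxz : x ≠ z) (hz : ∀ i, z ≠ t i) :
    (∏ i, g c x (t i)) * (g c x z * ∏ l, h c x (w l)) =
      g c x z * (∏ l, h c z (w l)) * (∏ i, g c z (t i)) +
      ∑ i, g c x (t i) * (∏ l ∈ univ.erase i, g c (t i) (t l)) *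
        (g c (t i) z * ∏ l, h c (t i) (w l)) := by
  -- The numerator has degree at most `n`, below the number `n + 1` of nodes. `Option (Fin n)`
  -- indexes these nodes, with `none` for the extra pole `z`.
  let P : Polynomial ℂ := ∏ l, (Polynomial.C c⁻¹ * Polynomial.X + Polynomial.C (1 - w l / c))
  have hPe : ∀ s, P.eval s = ∏ l, h c s (w l) := by
    intro s
    rw [Polynomial.eval_prod]
    refine prod_congr rfl fun l _ => ?_
    simp [h]
    field_simp
    ring
  have hP : P.degree < #(univ : Finset (Option (Fin n))) := by
    refine lt_of_le_of_lt (Polynomial.degree_prod_le _ _) ?_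
    refine lt_of_le_of_lt (sum_le_sum fun l _ => Polynomial.degree_linear_le) ?_
    simp
    exact_mod_cast Nat.lt_succ_self n
  have key := prod_g_mul_eval c (univ : Finset (Option (Fin n))) (fun o => o.elim z t)
    (by
      rintro (_ | a) _ (_ | b) _ hab
      · rfl
      · exact absurd hab (hz b)
      · exact absurd hab.symm (hz a)
      · exact congrArg _ (ht hab)) P hP x (by rintro (_ | a) _; exacts [hxz, hx a])
  rw [Fintype.prod_option, Fintype.sum_option] at key
  simp only [hPe, Option.elim] at key
  have e1 : ∏ l ∈ (univ : Finset (Option (Fin n))).erase none, g c z (l.elim z t) =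
      ∏ i, g c z (t i) := by
    have : (univ : Finset (Option (Fin n))).erase none = univ.map Function.Embedding.some := by
      ext o; cases o <;> simp
    rw [this, prod_map]
    rfl
  have e2 : ∀ i, ∏ l ∈ (univ : Finset (Option (Fin n))).erase (some i), g c (t i) (l.elim z t) =
      g c (t i) z * ∏ l ∈ univ.erase i, g c (t i) (t l) := by
    intro i
    have : (univ : Finset (Option (Fin n))).erase (some i) = insertNone (univ.erase i) := by
      ext o; cases o <;> simp
    rw [this, prod_insertNone]
    rfl
  erw [e1] at key
  have e3 := fun i => e2 i
  simp only [Option.elim] at e3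
  simp only [e3] at key
  calc _ = _ := by ring
    _ = _ := key
    _ = _ := by
      congr 1
      · exact sum_congr rfl fun i _ => by ring

/-- Expansion of the domain wall partition function with respect to its first variable. -/
theorem K_succ (c : ℂ) (hc : c ≠ 0) {n : ℕ} (x y : Fin (n + 1) → ℂ)
    (hx : Function.Injective x) (hy : Function.Injective y) (hxy : ∀ j k, x j ≠ y k)
    (hh : ∀ j k, h c (x j) (y k) ≠ 0) :
    K c x y = ∑ k : Fin (n + 1), g c (x 0) (y k) * (∏ l, f c (y k) (y (k.succAbove l))) *
      (∏ j : Fin n, f c (x j.succ) (y k)) *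
      K c (fun j => x j.succ) (fun l => y (k.succAbove l)) := by
  set m : Fin (n + 1) → ℂ := fun k => (Matrix.of fun i l : Fin n =>
    g c (x i.succ) (y (k.succAbove l)) / h c (x i.succ) (y (k.succAbove l))).det with hm
  set A := ∏ j : Fin n, ∏ k ∈ univ.filter (fun k => j < k), g c (x j.succ) (x k.succ) with hA
  set B := ∏ j : Fin (n + 1), ∏ k ∈ univ.filter (fun k => k < j), g c (y j) (y k) with hB
  set H := ∏ j : Fin n, ∏ k : Fin (n + 1), h c (x j.succ) (y k) with hH
  have hdet : (Matrix.of fun j k : Fin (n + 1) => g c (x j) (y k) / h c (x j) (y k)).det =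
      ∑ k : Fin (n + 1), (-1) ^ (k : ℕ) * (g c (x 0) (y k) / h c (x 0) (y k)) * m k := by
    rw [Matrix.det_succ_row_zero]
    rfl
  have hL : K c x y = A * B * H * ∑ k : Fin (n + 1), (-1) ^ (k : ℕ) * m k *
      ((∏ j : Fin n, g c (x 0) (x j.succ)) *
        (g c (x 0) (y k) * ∏ l : Fin n, h c (x 0) (y (k.succAbove l)))) := by
    rw [K, prod_g_succ, hdet, Fin.prod_univ_succ (fun j => ∏ k : Fin (n + 1), h c (x j) (y k)),
      mul_sum, mul_sum]
    refine sum_congr rfl fun k _ => ?_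
    rw [Fin.prod_univ_succAbove (fun l => h c (x 0) (y l)) k]
    have := hh 0 k
    field_simp
    ring
  have hpf : ∀ k : Fin (n + 1), _ := fun k => prod_h_partial_fraction c hc (x 0) (y k)
    (fun j : Fin n => x j.succ) (fun l : Fin n => y (k.succAbove l))
    (fun i j e => Fin.succ_injective _ (hx e)) (fun i e => (Fin.succ_ne_zero i).symm (hx e))
    (hxy 0 k) (fun i => (hxy _ _).symm)
  -- The residues at the points `x_i`, summed over the columns `k`, cancel for each `i` separately.
  have hS : ∑ k : Fin (n + 1), (-1) ^ (k : ℕ) * m k *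
      (∑ i : Fin n, g c (x 0) (x i.succ) *
        (∏ l ∈ univ.erase i, g c (x i.succ) (x l.succ)) *
        (g c (x i.succ) (y k) * ∏ l : Fin n, h c (x i.succ) (y (k.succAbove l)))) = 0 := by
    simp only [mul_sum]
    rw [sum_comm]
    refine sum_eq_zero fun i _ => ?_
    have := sum_minor_mul_prod_h c (fun j : Fin n => x j.succ) y (fun j k => hh _ _) i
    rw [← mul_zero (g c (x 0) (x i.succ) * ∏ l ∈ univ.erase i, g c (x i.succ) (x l.succ)), ← this,
      mul_sum]
    exact sum_congr rfl fun k _ => by ring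
  rw [hL]
  simp only [hpf, mul_add, sum_add_distrib]
  rw [hS, mul_zero, add_zero, mul_sum]
  refine sum_congr rfl fun k _ => ?_
  -- Reversing the arguments of `g` costs `(-1)^n` here and again in `hf2`, so the signs cancel.
  have hf1 : ∏ l, f c (y k) (y (k.succAbove l)) =
      (-1) ^ n * (∏ l, g c (y (k.succAbove l)) (y k)) * ∏ l, h c (y k) (y (k.succAbove l)) := by
    rw [← Fin.prod_const, ← prod_mul_distrib, ← prod_mul_distrib]
    refine prod_congr rfl fun l _ => ?_
    rw [f_eq_g_mul_h hc fun e => Fin.succAbove_ne k l (hy e).symm, g_swap c (y k)]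
    ring
  have hf2 : ∏ j : Fin n, f c (x j.succ) (y k) =
      (-1) ^ n * (∏ j : Fin n, g c (y k) (x j.succ)) * ∏ j : Fin n, h c (x j.succ) (y k) := by
    rw [← Fin.prod_const, ← prod_mul_distrib, ← prod_mul_distrib]
    refine prod_congr rfl fun l _ => ?_
    rw [f_eq_g_mul_h hc (hxy _ _), g_swap c (y k)]
    ring
  have hH' : H = (∏ j : Fin n, h c (x j.succ) (y k)) *
      ∏ j : Fin n, ∏ l : Fin n, h c (x j.succ) (y (k.succAbove l)) := by
    rw [hH, ← prod_mul_distrib]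
    exact prod_congr rfl fun j _ => Fin.prod_univ_succAbove _ k
  have hB' := prod_g_swap_succAbove c y k
  have hn : ((-1 : ℂ) ^ n) * (-1) ^ n = 1 := by rw [← mul_pow]; simp
  rw [K, hf1, hf2, hH']
  linear_combination (A * (∏ j : Fin n, h c (x j.succ) (y k)) *
      (∏ j : Fin n, ∏ l : Fin n, h c (x j.succ) (y (k.succAbove l))) * m k *
      (g c (x 0) (y k) * (∏ l, h c (y k) (y (k.succAbove l))) *
        ∏ j : Fin n, g c (y k) (x j.succ))) * hB' -
    (A * (∏ j : Fin n, h c (x j.succ) (y k)) *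
      (∏ j : Fin n, ∏ l : Fin n, h c (x j.succ) (y (k.succAbove l))) * m k *
      (g c (x 0) (y k) * (∏ l, h c (y k) (y (k.succAbove l))) *
        ∏ j : Fin n, g c (y k) (x j.succ))) *
      ((∏ j : Fin n, g c (y (k.succAbove j)) (y k)) *
        ∏ j : Fin n, ∏ l ∈ univ.filter (fun l => l < j),
          g c (y (k.succAbove j)) (y (k.succAbove l))) * hn

end Izergin

/-! ### The partition function for finite sets of variables -/

section IzerginFinset

variable {ι κ : Type*} [LinearOrder ι] [LinearOrder κ]

/-- The domain wall partition function of the variables `v_β` and `u_α`, extended by zero to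
sets of different cardinalities. -/
def KSet (c : ℂ) (u : ι → ℂ) (v : κ → ℂ) (β : Finset κ) (α : Finset ι) : ℂ :=
  if hc : #β = #α then
    K c (fun i => v (β.orderEmbOfFin hc i)) (fun i => u (α.orderEmbOfFin rfl i)) else 0

theorem exists_perm_of_image_eq {n : ℕ} (s : Finset ι) (hs : #s = n) (p : Fin n → ι)
    (hp : Function.Injective p) (hps : ∀ i, p i ∈ s) :
    ∃ σ : Equiv.Perm (Fin n), p = s.orderEmbOfFin hs ∘ σ := by
  have h1 : ∀ i, ∃ j, s.orderEmbOfFin hs j = p i := by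
    intro i
    have : p i ∈ Set.range (s.orderEmbOfFin hs) := by
      rw [range_orderEmbOfFin]
      exact hps i
    exact this
  choose τ hτ using h1
  have hinj : Function.Injective τ := fun i j e => hp (by rw [← hτ i, ← hτ j, e])
  exact ⟨Equiv.ofBijective τ (Finite.injective_iff_bijective.1 hinj), funext fun i => (hτ i).symm⟩

/-- By the symmetry of `K`, the increasing enumerations in the definition may be replaced by any
others; this allows a chosen variable to be put first. -/
theorem KSet_eq (c : ℂ) (u : ι → ℂ) (v : κ → ℂ) {n : ℕ} (β : Finset κ) (α : Finset ι)
    (hβ : #β = n) (hα : #α = n) (p : Fin n → κ) (q : Fin n → ι) (hp : Function.Injective p)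
    (hpβ : ∀ i, p i ∈ β) (hq : Function.Injective q) (hqα : ∀ i, q i ∈ α) :
    KSet c u v β α = K c (fun i => v (p i)) (fun i => u (q i)) := by
  subst hα
  obtain ⟨σ, rfl⟩ := exists_perm_of_image_eq β hβ p hp hpβ
  obtain ⟨τ, rfl⟩ := exists_perm_of_image_eq α rfl q hq hqα
  rw [KSet, dif_pos hβ]
  exact ((K_comp_perm_left c _ _ σ).trans (K_comp_perm_right c _ _ τ)).symm

theorem KSet_empty (c : ℂ) (u : ι → ℂ) (v : κ → ℂ) : KSet c u v ∅ ∅ = 1 := by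
  rw [KSet_eq c u v ∅ ∅ (n := 0) rfl rfl Fin.elim0 Fin.elim0 (fun i => i.elim0) (fun i => i.elim0)
    (fun i => i.elim0) (fun i => i.elim0)]
  simp [K]

theorem KSet_of_card_ne (c : ℂ) (u : ι → ℂ) (v : κ → ℂ) {β : Finset κ} {α : Finset ι}
    (hc : #β ≠ #α) : KSet c u v β α = 0 := dif_neg hc

/-- This is `K_succ` with `v_j` as the first variable. On the right `v_j` enters only through
`g(v_j, u_i)`, which is what makes later partial fractions in `v_j` elementary. For mismatched
cardinalities both sides vanish. -/
theorem KSet_insert (c : ℂ) (hc : c ≠ 0) (u : ι → ℂ) (v : κ → ℂ) (j : κ) (β : Finset κ)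
    (α : Finset ι) (hj : j ∉ β) (hu : Function.Injective u) (hv : Function.Injective v)
    (huv : ∀ i j, u i ≠ v j) (hvu : ∀ j i, h c (v j) (u i) ≠ 0) :
    KSet c u v (insert j β) α = ∑ i ∈ α, g c (v j) (u i) * (∏ i' ∈ α.erase i, f c (u i) (u i')) *
      (∏ l ∈ β, f c (v l) (u i)) * KSet c u v β (α.erase i) := by
  by_cases hcard : #α = #β + 1
  · set p : Fin (#β + 1) → κ := Fin.cons j (β.orderEmbOfFin rfl) with hp
    have hβmem : ∀ i, β.orderEmbOfFin rfl i ∈ β := fun i => orderEmbOfFin_mem _ _ _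
    have hpi : Function.Injective p := by
      rw [hp, Fin.cons_injective_iff]
      refine ⟨?_, (β.orderEmbOfFin rfl).injective⟩
      rintro ⟨i, rfl⟩
      exact hj (hβmem i)
    set q := α.orderEmbOfFin hcard with hq
    have hqmem : ∀ i, q i ∈ α := fun i => orderEmbOfFin_mem _ _ _
    have himg : univ.image q = α := by
      apply coe_injective
      simp [hq]
    have himgβ : univ.image (β.orderEmbOfFin rfl) = β := by
      apply coe_injective
      simp
    rw [KSet_eq c u v (insert j β) α (card_insert_of_notMem hj) hcard p q hpi
      (by
        intro i
        refine Fin.cases ?_ (fun i => ?_) i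
        · simp [hp]
        · simp [hp]) q.injective hqmem,
      K_succ c hc (fun i => v (p i)) (fun i => u (q i)) (hv.comp hpi) (hu.comp q.injective) (fun _ _ => (huv _ _).symm)
        (fun _ _ => hvu _ _)]
    conv_rhs => rw [← himg, sum_image q.injective.injOn, himg]
    refine sum_congr rfl fun k _ => ?_
    have herase : α.erase (q k) = univ.image (fun l => q (k.succAbove l)) := by
      ext i
      constructor
      · intro hi
        obtain ⟨hne, hi⟩ := mem_erase.1 hi
        rw [← himg] at hi
        obtain ⟨t, -, rfl⟩ := mem_image.1 hi
        obtain ⟨l, rfl⟩ := Fin.exists_succAbove_eq (fun e => hne (congrArg q e))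
        exact mem_image_of_mem _ (mem_univ _)
      · intro hi
        obtain ⟨l, -, rfl⟩ := mem_image.1 hi
        exact mem_erase.2 ⟨fun e => Fin.succAbove_ne k l (q.injective e), hqmem _⟩
    have hinj : Function.Injective (fun l => q (k.succAbove l)) :=
      q.injective.comp Fin.succAbove_right_injective
    have e1 : ∏ i' ∈ α.erase (q k), f c (u (q k)) (u i') =
        ∏ l, f c (u (q k)) (u (q (k.succAbove l))) := by
      rw [herase, prod_image hinj.injOn]
    have e2 : ∏ l ∈ β, f c (v l) (u (q k)) = ∏ l : Fin (#β), f c (v (p l.succ)) (u (q k)) := by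
      have := prod_image (s := univ) (f := fun l => f c (v l) (u (q k)))
        (β.orderEmbOfFin rfl).injective.injOn
      rw [himgβ] at this
      rw [this]
      simp [hp]
    rw [e1, e2, KSet_eq c u v β (α.erase (q k)) rfl (by simp [card_erase_of_mem (hqmem k), hcard])
      (fun l => p l.succ) (fun l => q (k.succAbove l))
      (fun a b e => Fin.succ_injective _ (hpi e)) (by simp [hp]) hinj
      (fun l => herase ▸ mem_image_of_mem _ (mem_univ l))]
    simp [hp]
  · rw [KSet_of_card_ne c u v (by rw [card_insert_of_notMem hj]; exact fun e => hcard e.symm)]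
    refine (sum_eq_zero fun i hi => ?_).symm
    rw [KSet_of_card_ne c u v, mul_zero]
    rw [card_erase_of_mem hi]
    have := card_pos.2 ⟨i, hi⟩
    omega

/-- Expansion of `f(v_γ, v_j) K(v_j, v_β | u_α)` into partial fractions in `v_j`. -/
theorem prod_f_mul_KSet_insert (c : ℂ) (hc : c ≠ 0) (u : ι → ℂ) (v : κ → ℂ) (j : κ)
    (β γ : Finset κ) (α : Finset ι) (hj : j ∉ β) (hjγ : j ∉ γ) (hβγ : Disjoint β γ)
    (hu : Function.Injective u) (hv : Function.Injective v)
    (huv : ∀ i j, u i ≠ v j) (hvu : ∀ j i, h c (v j) (u i) ≠ 0) :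
    (∏ l ∈ γ, f c (v l) (v j)) * KSet c u v (insert j β) α =
      (∑ k ∈ γ, g c (v k) (v j) * (∏ l ∈ γ.erase k, f c (v l) (v k)) *
        KSet c u v (insert k β) α) +
      ∑ i ∈ α, g c (v j) (u i) * (∏ i' ∈ α.erase i, f c (u i) (u i')) *
        (∏ l ∈ β, f c (v l) (u i)) * (∏ l ∈ γ, f c (v l) (u i)) * KSet c u v β (α.erase i) := by
  have h1 : ∑ k ∈ γ, g c (v k) (v j) * (∏ l ∈ γ.erase k, f c (v l) (v k)) *
        KSet c u v (insert k β) α = ∑ k ∈ γ, g c (v k) (v j) *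
        (∏ l ∈ γ.erase k, f c (v l) (v k)) * ∑ i ∈ α, g c (v k) (u i) *
          (∏ i' ∈ α.erase i, f c (u i) (u i')) *
          (∏ l ∈ β, f c (v l) (u i)) * KSet c u v β (α.erase i) :=
    sum_congr rfl fun k hk => by
      rw [KSet_insert c hc u v k β α (fun hb => disjoint_left.1 hβγ hb hk) hu hv huv hvu]
  rw [h1, KSet_insert c hc u v j β α hj hu hv huv hvu]
  simp only [mul_sum]
  rw [sum_comm, ← sum_add_distrib]
  refine sum_congr rfl fun i _ => ?_
  -- Since all dependence on the extracted variable is in `g(·, u_i)`, the claim for each `i` is the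
  -- scalar expansion with `y = u_i`.
  have h2 := prod_f_mul_g c γ v hv.injOn (v j) (u i) (huv i j).symm
    (fun k hk e => hjγ (hv e ▸ hk)) (fun k _ => (huv i k).symm)
  have h3 : ∑ k ∈ γ, g c (v k) (v j) * (∏ l ∈ γ.erase k, f c (v l) (v k)) *
      (g c (v k) (u i) * (∏ i' ∈ α.erase i, f c (u i) (u i')) *
        (∏ l ∈ β, f c (v l) (u i)) * KSet c u v β (α.erase i)) =
      (∑ k ∈ γ, g c (v k) (v j) * (∏ l ∈ γ.erase k, f c (v l) (v k)) * g c (v k) (u i)) *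
        ((∏ i' ∈ α.erase i, f c (u i) (u i')) *
        (∏ l ∈ β, f c (v l) (u i)) * KSet c u v β (α.erase i)) := by
    rw [sum_mul]
    exact sum_congr rfl fun k _ => by ring
  rw [h3]
  linear_combination ((∏ i' ∈ α.erase i, f c (u i) (u i')) *
        (∏ l ∈ β, f c (v l) (u i)) * KSet c u v β (α.erase i)) * h2

end IzerginFinset

/-! ### Commutation relations of individual operators -/

section Commutation

variable {A : Type*} [Ring A] [Algebra ℂ A] {c : ℂ} {T : Fin 3 → Fin 3 → ℂ → A}

theorem IsRTT.relation (hT : IsRTT c T) {i j k l : Fin 3} {x y : ℂ} (hxy : x ≠ y)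
    (hi : i ≠ 2) (hk : k ≠ 2) (hjl : j ≠ 2 ∨ l ≠ 2) :
    T i j x * T k l y - T k l y * T i j x = g c x y • (T k j y * T i l x - T k j x * T i l y) := by
  have := hT i j k l x y hxy
  rcases hjl with hj | hj <;> simpa [parity, hi, hk, hj] using this

theorem IsRTT.relation_odd (hT : IsRTT c T) {i k : Fin 3} {x y : ℂ} (hxy : x ≠ y)
    (hi : i ≠ 2) (hk : k ≠ 2) :
    T i 2 x * T k 2 y + T k 2 y * T i 2 x = g c x y • (T k 2 y * T i 2 x - T k 2 x * T i 2 y) := by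
  have := hT i 2 k 2 x y hxy
  simpa [parity, hi, hk] using this

/-- Interchanging `x` and `y` leaves the right side of the relation unchanged, since `g` is
antisymmetric. The commutator thus equals its own negative. -/
theorem IsRTT.commute_same (hT : IsRTT c T) {i j : Fin 3} (hi : i ≠ 2) (hj : j ≠ 2) (x y : ℂ) :
    Commute (T i j x) (T i j y) := by
  by_cases hxy : x = y
  · rw [hxy]
  have h1 := hT.relation hxy hi hi (Or.inl hj) (l := j)
  have h2 := hT.relation (Ne.symm hxy) hi hi (Or.inl hj) (l := j)
  rw [g_swap c x y] at h2
  have h3 : (2 : ℂ) • (T i j x * T i j y - T i j y * T i j x) = 0 := by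
    linear_combination (norm := module) h1 - h2
  rcases smul_eq_zero.1 h3 with h4 | h4
  · norm_num at h4
  · exact sub_eq_zero.1 h4

theorem IsRTT.T11_mul_T01 (hT : IsRTT c T) {x y : ℂ} (hxy : x ≠ y) :
    T 1 1 x * T 0 1 y = f c x y • (T 0 1 y * T 1 1 x) - g c x y • (T 0 1 x * T 1 1 y) := by
  have h1 := hT.relation hxy (i := 1) (j := 1) (k := 0) (l := 1) (by decide) (by decide)
    (by decide)
  rw [f]
  linear_combination (norm := module) h1

theorem IsRTT.T01_mul_T12 (hT : IsRTT c T) {z x : ℂ} (hxz : x ≠ z) :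
    T 0 1 z * T 1 2 x = T 1 2 x * T 0 1 z + g c x z • (T 0 2 x * T 1 1 z)
      - g c x z • (T 0 2 z * T 1 1 x) := by
  have h1 := hT.relation hxz (i := 1) (j := 2) (k := 0) (l := 1) (by decide) (by decide)
    (by decide)
  linear_combination (norm := module) -h1

theorem IsRTT.T01_mul_T02 (hT : IsRTT c T) {z x : ℂ} (hxz : x ≠ z) :
    T 0 1 z * T 0 2 x = f c x z • (T 0 2 x * T 0 1 z) - g c x z • (T 0 2 z * T 0 1 x) := by
  have h1 := hT.relation hxz (i := 0) (j := 2) (k := 0) (l := 1) (by decide) (by decide)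
    (by decide)
  rw [f]
  linear_combination (norm := module) -h1

theorem IsRTT.T11_mul_T12 (hT : IsRTT c T) {z x : ℂ} (hxz : x ≠ z) :
    T 1 1 z * T 1 2 x = f c x z • (T 1 2 x * T 1 1 z) - g c x z • (T 1 2 z * T 1 1 x) := by
  have h1 := hT.relation hxz (i := 1) (j := 2) (k := 1) (l := 1) (by decide) (by decide)
    (by decide)
  rw [f]
  linear_combination (norm := module) -h1

theorem IsRTT.T11_mul_T02 (hT : IsRTT c T) {z x : ℂ} (hxz : x ≠ z) :
    T 1 1 z * T 0 2 x = T 0 2 x * T 1 1 z + g c x z • (T 1 2 x * T 0 1 z)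
      - g c x z • (T 1 2 z * T 0 1 x) := by
  have h1 := hT.relation hxz (i := 0) (j := 2) (k := 1) (l := 1) (by decide) (by decide)
    (by decide)
  linear_combination (norm := module) -h1

theorem g_mul_h_swap {c x y : ℂ} (hc : c ≠ 0) (hxy : x ≠ y) :
    g c y x * h c x y = g c y x - 1 := by
  rw [g_swap, neg_mul, ← f_eq_g_mul_h hc hxy, f]
  ring

theorem IsRTT.T12_mul_T02 (hT : IsRTT c T) (hc : c ≠ 0) {x y : ℂ} (hxy : x ≠ y) :
    T 1 2 y * T 0 2 x =
      (g c y x * h c x y) • (T 0 2 x * T 1 2 y) - g c y x • (T 0 2 y * T 1 2 x) := by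
  have h1 := hT.relation_odd hxy.symm (i := 1) (k := 0) (by decide) (by decide)
  rw [g_mul_h_swap hc hxy]
  linear_combination (norm := module) h1

/-- The anticommutation relation is this identity multiplied by the nonzero factor `g(x, y)`. It is
the source of the symmetry of the products normalized by `h`. -/
theorem IsRTT.exchange (hT : IsRTT c T) (hc : c ≠ 0) {i : Fin 3} (hi : i ≠ 2) {x y : ℂ}
    (hxy : x ≠ y) : h c x y • (T i 2 x * T i 2 y) = h c y x • (T i 2 y * T i 2 x) := by
  have h1 := hT.relation_odd hxy hi hi
  have h2 : g c x y • (h c x y • (T i 2 x * T i 2 y)) =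
      g c x y • (h c y x • (T i 2 y * T i 2 x)) := by
    rw [smul_smul, smul_smul, g_mul_h_swap hc hxy.symm, ← f_eq_g_mul_h hc hxy, f]
    linear_combination (norm := module) h1
  exact smul_right_injective _ (g_ne_zero hc hxy) h2

end Commutation

/-! ### Ordered products and the symmetry of the normalized ones -/

section OrderedProducts

variable {A : Type*} [Ring A] {ι : Type*} [LinearOrder ι]

theorem opProd_eq_noncommProd (O : ℂ → A) (hO : ∀ x y, Commute (O x) (O y)) (w : ι → ℂ)
    (s : Finset ι) : opProd O w s = s.noncommProd (fun k => O (w k)) (fun _ _ _ _ _ => hO _ _) := by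
  have : ∀ (m : Multiset A) (hm) (l : List A), m = l → l.prod = m.noncommProd hm := by
    rintro _ hm l rfl
    rw [Multiset.noncommProd_coe]
  refine this _ _ _ ?_
  rw [← Multiset.map_coe, sort_eq]

theorem opProd_empty (O : ℂ → A) (w : ι → ℂ) : opProd O w ∅ = 1 := by
  simp [opProd]

theorem opProd_insert (O : ℂ → A) (hO : ∀ x y, Commute (O x) (O y)) (w : ι → ℂ)
    {s : Finset ι} {k : ι} (hk : k ∉ s) : opProd O w (insert k s) = opProd O w s * O (w k) := by
  rw [opProd_eq_noncommProd O hO, opProd_eq_noncommProd O hO]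
  exact noncommProd_insert_of_notMem' _ _ _ _ hk

theorem opProd_insert_min (O : ℂ → A) (w : ι → ℂ)
    {s : Finset ι} {k : ι} (hk : ∀ l ∈ s, k < l) :
    opProd O w (insert k s) = O (w k) * opProd O w s := by
  rw [opProd, sort_insert _ (fun b hb => (hk b hb).le) (fun hm => (hk k hm).false), List.map_cons,
    List.prod_cons, opProd]

variable [Algebra ℂ A]

/-- The normalization of the symmetric products. -/
def symNorm (c : ℂ) (w : ι → ℂ) (s : Finset ι) : ℂ :=
  ∏ l ∈ s, ∏ m ∈ s.filter (fun m => m < l), h c (w l) (w m)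

theorem symNorm_insert (c : ℂ) (w : ι → ℂ) {s : Finset ι} {k : ι} (hk : k ∉ s) :
    symNorm c w (insert k s) =
      (∏ l ∈ s, if k < l then h c (w l) (w k) else h c (w k) (w l)) * symNorm c w s := by
  have h1 : ∀ l ∈ s, ∏ m ∈ (insert k s).filter (fun m => m < l), h c (w l) (w m) =
      (if k < l then h c (w l) (w k) else 1) * ∏ m ∈ s.filter (fun m => m < l), h c (w l) (w m) := by
    intro l _
    rw [filter_insert]
    split_ifs
    · rw [prod_insert (fun hm => hk (mem_filter.1 hm).1)]
    · rw [one_mul]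
  have h2 : ∏ m ∈ (insert k s).filter (fun m => m < k), h c (w k) (w m) =
      ∏ l ∈ s, if k < l then 1 else h c (w k) (w l) := by
    rw [filter_insert, if_neg (lt_irrefl k), prod_filter]
    refine prod_congr rfl fun l hl => ?_
    rcases lt_trichotomy k l with hkl | hkl | hkl
    · rw [if_neg hkl.not_gt, if_pos hkl]
    · exact absurd (hkl ▸ hl) hk
    · rw [if_pos hkl, if_neg hkl.not_gt]
  rw [symNorm, prod_insert hk, prod_congr rfl h1, h2, prod_mul_distrib, ← mul_assoc,
    ← prod_mul_distrib, symNorm]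
  congr 1
  exact prod_congr rfl fun l _ => by split_ifs <;> simp

theorem symNorm_ne_zero (c : ℂ) (w : ι → ℂ) (hw : ∀ j k, j ≠ k → h c (w j) (w k) ≠ 0)
    (s : Finset ι) : symNorm c w s ≠ 0 :=
  prod_ne_zero_iff.2 fun _ _ => prod_ne_zero_iff.2 fun _ hm => hw _ _ (mem_filter.1 hm).2.ne'

theorem symProd_empty (c : ℂ) (O : ℂ → A) (w : ι → ℂ) : symProd c O w ∅ = 1 := by
  simp [symProd, opProd]

theorem mul_symProd_of_min (c : ℂ) (O : ℂ → A) (w : ι → ℂ)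
    (hw : ∀ j k, j ≠ k → h c (w j) (w k) ≠ 0) {s : Finset ι} {k : ι} (hk : ∀ l ∈ s, k < l) :
    O (w k) * symProd c O w s = (∏ l ∈ s, h c (w l) (w k)) • symProd c O w (insert k s) := by
  have hks : k ∉ s := fun hm => (hk k hm).false
  have h1 : ∏ l ∈ s, h c (w l) (w k) ≠ 0 :=
    prod_ne_zero_iff.2 fun l hl => hw _ _ (hk l hl).ne'
  have h2 : symNorm c w (insert k s) = (∏ l ∈ s, h c (w l) (w k)) * symNorm c w s := by
    rw [symNorm_insert c w hks]
    congr 1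
    exact prod_congr rfl fun l hl => if_pos (hk l hl)
  change O (w k) * ((symNorm c w s)⁻¹ • _) = _ • ((symNorm c w (insert k s))⁻¹ • _)
  rw [opProd_insert_min O w hk, h2, mul_inv, smul_smul, mul_inv_cancel_left₀ h1, mul_smul_comm]

/-- Symmetry of the symmetric product: any variable can be extracted on the left. -/
theorem mul_symProd (c : ℂ) (O : ℂ → A) (w : ι → ℂ)
    (hw : ∀ j k, j ≠ k → h c (w j) (w k) ≠ 0)
    (hO : ∀ j k, j ≠ k → h c (w j) (w k) • (O (w j) * O (w k)) =
      h c (w k) (w j) • (O (w k) * O (w j)))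
    {s : Finset ι} {k : ι} (hk : k ∉ s) :
    O (w k) * symProd c O w s = (∏ l ∈ s, h c (w l) (w k)) • symProd c O w (insert k s) := by
  induction s using Finset.induction_on_min with
  | empty => simpa using mul_symProd_of_min c O w hw (s := ∅) (k := k) (by simp)
  | insert m s hm ih =>
    have hms : m ∉ s := fun h' => (hm m h').false
    have hks : k ∉ s := fun h' => hk (mem_insert_of_mem h')
    have hkm : k ≠ m := fun e => hk (e ▸ mem_insert_self _ _)
    rcases lt_or_gt_of_ne hkm with hlt | hlt
    · refine mul_symProd_of_min c O w hw fun l hl => ?_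
      rcases mem_insert.1 hl with rfl | hl
      · exact hlt
      · exact hlt.trans (hm l hl)
    · have e1 := mul_symProd_of_min c O w hw hm
      have e2 := mul_symProd_of_min c O w hw (s := insert k s) (k := m) (by
        intro l hl
        rcases mem_insert.1 hl with rfl | hl
        · exact hlt
        · exact hm l hl)
      have e3 := ih hks
      have e4 := hO m k hkm.symm
      rw [insert_comm, prod_insert hks] at e2
      rw [prod_insert hms]
      -- Multiplying by this nonzero factor splits the minimal `O(w_m)` off the product, so that
      -- `O(w_k)` can be exchanged with it and the induction hypothesis applied.
      have h1 : h c (w k) (w m) * ∏ l ∈ s, h c (w l) (w m) ≠ 0 :=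
        mul_ne_zero (hw _ _ hkm) (prod_ne_zero_iff.2 fun l hl => hw _ _ (hm l hl).ne')
      refine smul_right_injective A h1 ?_
      calc (h c (w k) (w m) * ∏ l ∈ s, h c (w l) (w m)) • (O (w k) * symProd c O w (insert m s))
          = h c (w k) (w m) • (O (w k) * ((∏ l ∈ s, h c (w l) (w m)) •
              symProd c O w (insert m s))) := by rw [mul_smul_comm, smul_smul]
        _ = (h c (w k) (w m) • (O (w k) * O (w m))) * symProd c O w s := by
            rw [← e1, smul_mul_assoc, mul_assoc]
        _ = h c (w m) (w k) • (O (w m) * (O (w k) * symProd c O w s)) := by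
            rw [← e4, smul_mul_assoc, mul_assoc]
        _ = _ := by
            rw [e3, mul_smul_comm, e2]
            module

end OrderedProducts

/-! ### Moving `T_{23}` through a product of `T_{13}` -/

section SymmetricProducts

variable {A : Type*} [Ring A] [Algebra ℂ A] {c : ℂ} {T : Fin 3 → Fin 3 → ℂ → A}
  {κ : Type*} [LinearOrder κ]

/-- Moving `T_{23}` through a symmetric product of `T_{13}`. -/
theorem IsRTT.T12_mul_symProd (hT : IsRTT c T) (hc : c ≠ 0) (v : κ → ℂ)
    (hv : Function.Injective v) (hvv : ∀ j k, j ≠ k → h c (v j) (v k) ≠ 0) (β : Finset κ) (j : κ)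
    (hj : j ∉ β) :
    T 1 2 (v j) * symProd c (T 0 2) v β =
      (∏ l ∈ β, (g c (v j) (v l) * h c (v l) (v j))) • (symProd c (T 0 2) v β * T 1 2 (v j)) -
      ∑ k ∈ β, (g c (v j) (v k) * ∏ l ∈ β.erase k, g c (v k) (v l)) •
        (T 0 2 (v j) * symProd c (T 0 2) v (β.erase k) * T 1 2 (v k)) := by
  have hO : ∀ j k, j ≠ k → h c (v j) (v k) • (T 0 2 (v j) * T 0 2 (v k)) =
      h c (v k) (v j) • (T 0 2 (v k) * T 0 2 (v j)) :=
    fun j k hjk => hT.exchange hc (by decide) (hv.ne hjk)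
  induction β using Finset.induction_on generalizing j with
  | empty => simp [symProd_empty]
  | insert k β hk ih =>
    have hjk : j ≠ k := fun e => hj (e ▸ mem_insert_self _ _)
    have hjβ : j ∉ β := fun h' => hj (mem_insert_of_mem h')
    have hη : ∏ l ∈ β, h c (v l) (v k) ≠ 0 :=
      prod_ne_zero_iff.2 fun l hl => hvv _ _ fun (e : l = k) => hk (e ▸ hl)
    refine smul_right_injective A hη ?_
    have e1 := mul_symProd c (T 0 2) v hvv hO hk
    have e2 := hT.T12_mul_T02 hc (hv.ne hjk.symm)
    have e3 := hO k j hjk.symm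
    have e4 : ∀ m ∈ β, T 0 2 (v k) * symProd c (T 0 2) v (β.erase m) =
        (∏ l ∈ β.erase m, h c (v l) (v k)) • symProd c (T 0 2) v ((insert k β).erase m) := by
      intro m hm
      rw [mul_symProd c (T 0 2) v hvv hO (fun h' => hk (mem_of_mem_erase h')),
        erase_insert_of_ne (fun (e : k = m) => hk (e ▸ hm))]
    set X := T 0 2 (v j) with hX
    have s1 : ∑ m ∈ β, (∏ l ∈ β, h c (v l) (v k)) • ((g c (v j) (v m) *
        ∏ l ∈ (insert k β).erase m, g c (v m) (v l)) •
        (X * symProd c (T 0 2) v ((insert k β).erase m) * T 1 2 (v m))) =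
      ∑ m ∈ β, ((g c (v j) (v k) * h c (v k) (v j)) • (T 0 2 (v k) * ((g c (v j) (v m) *
        ∏ l ∈ β.erase m, g c (v m) (v l)) •
        (X * symProd c (T 0 2) v (β.erase m) * T 1 2 (v m)))) -
        g c (v j) (v k) • (X * ((g c (v k) (v m) * ∏ l ∈ β.erase m, g c (v m) (v l)) •
        (T 0 2 (v k) * symProd c (T 0 2) v (β.erase m) * T 1 2 (v m))))) := by
      refine sum_congr rfl fun m hm => ?_
      have hmk : m ≠ k := fun e => hk (e ▸ hm)
      have hmj : m ≠ j := fun e => hjβ (e ▸ hm)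
      have t1 : (g c (v j) (v k) * h c (v k) (v j)) • (T 0 2 (v k) * ((g c (v j) (v m) *
        ∏ l ∈ β.erase m, g c (v m) (v l)) •
        (X * symProd c (T 0 2) v (β.erase m) * T 1 2 (v m)))) =
        (g c (v j) (v k) * h c (v j) (v k) * (g c (v j) (v m) *
        ∏ l ∈ β.erase m, g c (v m) (v l))) •
        (X * (T 0 2 (v k) * symProd c (T 0 2) v (β.erase m)) * T 1 2 (v m)) := by
        have := congrArg (fun t => (g c (v j) (v k) * (g c (v j) (v m) *
          ∏ l ∈ β.erase m, g c (v m) (v l))) • (t * symProd c (T 0 2) v (β.erase m) *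
            T 1 2 (v m))) e3
        simp only [smul_mul_assoc, mul_smul_comm, smul_smul, mul_assoc] at this ⊢
        convert this using 2 <;> ring
      have hp : ∏ l ∈ (insert k β).erase m, g c (v m) (v l) =
          g c (v m) (v k) * ∏ l ∈ β.erase m, g c (v m) (v l) := by
        rw [erase_insert_of_ne hmk.symm, prod_insert (fun h' => hk (mem_of_mem_erase h'))]
      -- A term ending in `T_{23}(v_m)` arises in two ways: `v_j` is exchanged directly with `v_m`,
      -- or first with `v_k`, which is then exchanged with `v_m`. This identity adds the two
      -- coefficients.
      have key : h c (v m) (v k) * (g c (v j) (v m) * g c (v m) (v k)) =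
          g c (v j) (v k) * h c (v j) (v k) * g c (v j) (v m) - g c (v j) (v k) * g c (v k) (v m) := by
        rw [← f_eq_g_mul_h hc (hv.ne hjk)]
        have := f_eq_g_mul_h hc (hv.ne hmk)
        rw [show h c (v m) (v k) * (g c (v j) (v m) * g c (v m) (v k)) =
          g c (v j) (v m) * f c (v m) (v k) by rw [this]; ring, g_swap c (v m) (v k)]
        have := sub_ne_zero.2 (hv.ne hjk)
        have := sub_ne_zero.2 (hv.ne hmk)
        have := sub_ne_zero.2 (hv.ne hmj.symm)
        unfold f g
        field_simp
        ring
      rw [t1, e4 m hm, hp, ← mul_prod_erase β (fun l => h c (v l) (v k)) hm]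
      simp only [smul_mul_assoc, mul_smul_comm, smul_smul, mul_assoc, ← sub_smul]
      congr 1
      linear_combination (∏ l ∈ β.erase m, h c (v l) (v k)) *
        (∏ l ∈ β.erase m, g c (v m) (v l)) * key
    have s2 : (∏ l ∈ β, h c (v l) (v k)) • ∑ m ∈ β, ((g c (v j) (v m) *
        ∏ l ∈ (insert k β).erase m, g c (v m) (v l)) •
        (X * symProd c (T 0 2) v ((insert k β).erase m) * T 1 2 (v m))) =
        (g c (v j) (v k) * h c (v k) (v j)) • (T 0 2 (v k) * ∑ m ∈ β, ((g c (v j) (v m) *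
        ∏ l ∈ β.erase m, g c (v m) (v l)) •
        (X * symProd c (T 0 2) v (β.erase m) * T 1 2 (v m)))) -
        g c (v j) (v k) • (X * ∑ m ∈ β, ((g c (v k) (v m) * ∏ l ∈ β.erase m, g c (v m) (v l)) •
        (T 0 2 (v k) * symProd c (T 0 2) v (β.erase m) * T 1 2 (v m)))) := by
      rw [smul_sum, s1, sum_sub_distrib]
      simp only [mul_sum, smul_sum]
    have e5 : (∏ l ∈ β, h c (v l) (v k)) • (T 1 2 (v j) * symProd c (T 0 2) v (insert k β)) =
        (g c (v j) (v k) * h c (v k) (v j)) • (T 0 2 (v k) * (T 1 2 (v j) * symProd c (T 0 2) v β))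
        - g c (v j) (v k) • (X * (T 1 2 (v k) * symProd c (T 0 2) v β)) := by
      rw [← mul_smul_comm, ← e1, ← mul_assoc, e2, sub_mul, smul_mul_assoc, smul_mul_assoc,
        mul_assoc, mul_assoc]
    have e6 : T 0 2 (v k) * (symProd c (T 0 2) v β * T 1 2 (v j)) =
        (∏ l ∈ β, h c (v l) (v k)) • (symProd c (T 0 2) v (insert k β) * T 1 2 (v j)) := by
      rw [← mul_assoc, e1, smul_mul_assoc]
    dsimp only
    rw [e5, ih j hjβ, ih k hk, smul_sub, sum_insert hk, erase_insert hk, smul_add, s2,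
      prod_insert hk, mul_sub, mul_sub, mul_smul_comm, mul_smul_comm, e6, prod_mul_distrib (s := β)
      (f := fun l => g c (v k) (v l)), mul_assoc X]
    module

end SymmetricProducts

/-! ### Reindexing sums over subsets with a marked element -/

section PowersetSums

variable {A ι : Type*} [AddCommMonoid A] [DecidableEq ι]

theorem sum_powerset_sum_mem (J : Finset ι) (G : ι → Finset ι → A) :
    ∑ β ∈ J.powerset, ∑ k ∈ β, G k (β.erase k) = ∑ β ∈ J.powerset, ∑ k ∈ J \ β, G k β := by
  rw [sum_sigma', sum_sigma']
  refine sum_bij' (fun p _ => ⟨p.1.erase p.2, p.2⟩) (fun p _ => ⟨insert p.2 p.1, p.2⟩) ?_ ?_ ?_ ?_ ?_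
  · rintro ⟨β, k⟩ hp
    obtain ⟨h1, h2⟩ := mem_sigma.1 hp
    rw [mem_powerset] at h1
    simp only [mem_sigma, mem_powerset, mem_sdiff, mem_erase]
    exact ⟨(erase_subset _ _).trans h1, h1 h2, by simp⟩
  · rintro ⟨β, k⟩ hp
    simp only [mem_sigma, mem_powerset, mem_sdiff] at hp ⊢
    exact ⟨insert_subset hp.2.1 hp.1, mem_insert_self _ _⟩
  · rintro ⟨β, k⟩ hp
    obtain ⟨h1, h2⟩ := mem_sigma.1 hp
    simp only [insert_erase h2]
  · rintro ⟨β, k⟩ hp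
    simp only [mem_sigma, mem_powerset, mem_sdiff] at hp
    simp only [erase_insert hp.2.2]
  · rintro ⟨β, k⟩ _
    rfl

theorem sum_sum_powerset_erase (I : Finset ι) (G : ι → Finset ι → A) :
    ∑ i ∈ I, ∑ α ∈ (I.erase i).powerset, G i α =
      ∑ α ∈ I.powerset, ∑ i ∈ α, G i (α.erase i) := by
  rw [sum_powerset_sum_mem]
  refine sum_comm' fun i α => ?_
  simp only [mem_powerset, mem_sdiff, subset_erase]
  tauto

end PowersetSums

/-! ### Recursion of `Y` in the variables `v` -/

section Recursion

variable {A : Type*} [Ring A] [Algebra ℂ A] {ι κ : Type*} [LinearOrder ι] [LinearOrder κ]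

theorem Y_eq_sum (c : ℂ) (T : Fin 3 → Fin 3 → ℂ → A) (u : ι → ℂ) (v : κ → ℂ)
    (I : Finset ι) (J : Finset κ) :
    Y c T u v I J = ∑ α ∈ I.powerset, ∑ β ∈ J.powerset,
      (KSet c u v β α * (∏ i ∈ α, ∏ i' ∈ I \ α, f c (u i) (u i')) *
        (∏ j ∈ J \ β, ∏ j' ∈ β, g c (v j) (v j'))) •
        (symProd c (T 0 2) v β * symProd c (T 1 2) v (J \ β) *
          opProd (T 0 1) u (I \ α) * opProd (T 1 1) u α) := by
  refine sum_congr rfl fun α _ => sum_congr rfl fun β _ => ?_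
  by_cases hc : #β = #α
  · rw [dif_pos hc, KSet, dif_pos hc]
  · rw [dif_neg hc, KSet, dif_neg hc, zero_mul, zero_mul, zero_smul]

theorem Y_empty_right (c : ℂ) (T : Fin 3 → Fin 3 → ℂ → A) (u : ι → ℂ) (v : κ → ℂ)
    (I : Finset ι) : Y c T u v I ∅ = opProd (T 0 1) u I := by
  rw [Y_eq_sum, sum_eq_single ∅]
  · simp [KSet_empty, symProd_empty, opProd_empty]
  · intro α _ hα
    simp only [powerset_empty, sum_singleton]
    rw [KSet_of_card_ne c u v (fun e => hα (card_eq_zero.1 (by simpa using e.symm))), zero_mul, zero_mul, zero_smul]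
  · simp

/-- Extraction of the smallest `v`-variable from `Y`. -/
theorem Y_insert_min {c : ℂ} (hc : c ≠ 0) {T : Fin 3 → Fin 3 → ℂ → A} (hT : IsRTT c T)
    (u : ι → ℂ) (v : κ → ℂ) (hu : Function.Injective u) (hv : Function.Injective v)
    (huv : ∀ i j, u i ≠ v j) (hvv : ∀ j k, j ≠ k → h c (v j) (v k) ≠ 0)
    (hvu : ∀ j i, h c (v j) (u i) ≠ 0) (I : Finset ι) (J : Finset κ) (j : κ)
    (hj : ∀ l ∈ J, j < l) :
    (∏ l ∈ J, h c (v l) (v j)) • Y c T u v I (insert j J) = T 1 2 (v j) * Y c T u v I J +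
      ∑ i ∈ I, (g c (v j) (u i) * (∏ i' ∈ I.erase i, f c (u i) (u i')) *
        ∏ l ∈ J, f c (v l) (u i)) • (T 0 2 (v j) * Y c T u v (I.erase i) J * T 1 1 (u i)) := by
  have hjJ : j ∉ J := fun hm => (hj j hm).false
  have hO : ∀ (r : Fin 3), r ≠ 2 → ∀ j k, j ≠ k →
      h c (v j) (v k) • (T r 2 (v j) * T r 2 (v k)) =
      h c (v k) (v j) • (T r 2 (v k) * T r 2 (v j)) :=
    fun r hr j k hjk => hT.exchange hc hr (hv.ne hjk)
  set F : Finset ι → ℂ := fun α => ∏ i ∈ α, ∏ i' ∈ I \ α, f c (u i) (u i') with hF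
  set G : Finset κ → ℂ := fun β => ∏ l ∈ J \ β, ∏ j' ∈ β, g c (v l) (v j') with hG
  set D : Finset ι → A := fun α => opProd (T 0 1) u (I \ α) * opProd (T 1 1) u α with hD
  -- the terms where `v_j` belongs to the second factor
  set Z : A := ∑ α ∈ I.powerset, ∑ β ∈ J.powerset,
    (KSet c u v β α * F α * G β * ∏ l ∈ β, (g c (v j) (v l) * h c (v l) (v j))) •
      (symProd c (T 0 2) v β * T 1 2 (v j) * symProd c (T 1 2) v (J \ β) * D α) with hZ
  set E : Finset κ → Finset ι → A := fun β α =>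
    T 0 2 (v j) * symProd c (T 0 2) v β * symProd c (T 1 2) v (J \ β) * D α with hE
  -- Subsets of `insert j J` are split by whether they contain `j`; those without `j` give `Z`.
  have hL : (∏ l ∈ J, h c (v l) (v j)) • Y c T u v I (insert j J) = Z +
      ∑ α ∈ I.powerset, ∑ β ∈ J.powerset,
        ((∏ l ∈ J \ β, f c (v l) (v j)) * KSet c u v (insert j β) α * F α * G β) • E β α := by
    rw [Y_eq_sum, hZ, smul_sum, ← sum_add_distrib]
    refine sum_congr rfl fun α _ => ?_
    rw [sum_powerset_insert hjJ, smul_add, smul_sum, smul_sum]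
    congr 1
    · refine sum_congr rfl fun β hβ => ?_
      rw [mem_powerset] at hβ
      have hjβ : j ∉ J \ β := fun hm => hjJ (mem_sdiff.1 hm).1
      have e1 : insert j J \ β = insert j (J \ β) := insert_sdiff_of_notMem _ (fun hm => hjJ (hβ hm))
      have e2 := mul_symProd c (T 1 2) v hvv (hO 1 (by decide)) hjβ
      rw [e1, prod_insert hjβ, mul_assoc _ (T 1 2 (v j)), e2, ← prod_sdiff hβ, prod_mul_distrib]
      simp only [hF, hG, hD, smul_smul, smul_mul_assoc, mul_smul_comm, mul_assoc]
      congr 1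
      ring
    · refine sum_congr rfl fun β hβ => ?_
      rw [mem_powerset] at hβ
      have hjβ : j ∉ β := fun hm => hjJ (hβ hm)
      have e1 : insert j J \ insert j β = J \ β := by
        rw [insert_sdiff_insert, sdiff_insert_of_notMem hjJ]
      have e2 := mul_symProd c (T 0 2) v hvv (hO 0 (by decide)) hjβ
      have e3 : ∏ l ∈ J \ β, ∏ j' ∈ insert j β, g c (v l) (v j') =
          (∏ l ∈ J \ β, g c (v l) (v j)) * G β := by
        rw [hG, ← prod_mul_distrib]
        exact prod_congr rfl fun l _ => prod_insert hjβ
      have e4 : ∏ l ∈ J \ β, f c (v l) (v j) =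
          (∏ l ∈ J \ β, g c (v l) (v j)) * ∏ l ∈ J \ β, h c (v l) (v j) := by
        rw [← prod_mul_distrib]
        exact prod_congr rfl fun l hl =>
          f_eq_g_mul_h hc (hv.ne fun e => hjJ (e ▸ (mem_sdiff.1 hl).1))
      rw [e1, e3, e4, hE, ← prod_sdiff hβ]
      dsimp only
      rw [e2]
      simp only [hF, hD, smul_smul, smul_mul_assoc, mul_assoc]
      congr 1
      ring
  -- The direct passage of `T_{23}(v_j)` gives `Z`. In the other terms `v_j` replaces some `v_k` in
  -- `β`, and `v_k` joins the `T_{23}`-product; renaming `β.erase k` to `β` makes `k` run over `J \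
  -- β`.
  have hA : T 1 2 (v j) * Y c T u v I J = Z +
      ∑ α ∈ I.powerset, ∑ β ∈ J.powerset, ∑ k ∈ J \ β,
        (g c (v k) (v j) * (∏ l ∈ (J \ β).erase k, f c (v l) (v k)) *
          KSet c u v (insert k β) α * F α * G β) • E β α := by
    rw [Y_eq_sum, hZ, mul_sum, ← sum_add_distrib]
    refine sum_congr rfl fun α _ => ?_
    rw [← sum_powerset_sum_mem J (fun k β => (g c (v k) (v j) *
      (∏ l ∈ (J \ β).erase k, f c (v l) (v k)) * KSet c u v (insert k β) α * F α * G β) • E β α),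
      mul_sum, ← sum_add_distrib]
    refine sum_congr rfl fun β hβ => ?_
    rw [mem_powerset] at hβ
    have hjβ : j ∉ β := fun hm => hjJ (hβ hm)
    have e1 := hT.T12_mul_symProd hc v hv hvv β j hjβ
    have e2 : ∑ k ∈ β, (g c (v k) (v j) *
        (∏ l ∈ (J \ β.erase k).erase k, f c (v l) (v k)) *
        KSet c u v (insert k (β.erase k)) α * F α * G (β.erase k)) • E (β.erase k) α =
        ∑ k ∈ β, (KSet c u v β α * F α * G β) • (-((g c (v j) (v k) *
          ∏ l ∈ β.erase k, g c (v k) (v l)) •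
          (T 0 2 (v j) * symProd c (T 0 2) v (β.erase k) * T 1 2 (v k))) *
          symProd c (T 1 2) v (J \ β) * D α) := by
      refine sum_congr rfl fun k hk => ?_
      have hkJ : k ∉ J \ β := fun hm => (mem_sdiff.1 hm).2 hk
      have s1 : J \ β.erase k = insert k (J \ β) := sdiff_erase (hβ hk)
      have s2 : G (β.erase k) = (∏ l ∈ β.erase k, g c (v k) (v l)) *
          ∏ l ∈ J \ β, ∏ j' ∈ β.erase k, g c (v l) (v j') := by
        simp only [hG]
        rw [s1, prod_insert hkJ]
      have s3 : G β = (∏ l ∈ J \ β, g c (v l) (v k)) *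
          ∏ l ∈ J \ β, ∏ j' ∈ β.erase k, g c (v l) (v j') := by
        simp only [hG]
        rw [← prod_mul_distrib]
        exact prod_congr rfl fun l _ => (mul_prod_erase β (fun j' => g c (v l) (v j')) hk).symm
      have s4 : ∏ l ∈ J \ β, f c (v l) (v k) =
          (∏ l ∈ J \ β, g c (v l) (v k)) * ∏ l ∈ J \ β, h c (v l) (v k) := by
        rw [← prod_mul_distrib]
        exact prod_congr rfl fun l hl =>
          f_eq_g_mul_h hc (hv.ne fun e => hkJ (e ▸ hl))
      have s5 := mul_symProd c (T 1 2) v hvv (hO 1 (by decide)) hkJ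
      rw [s2, s3, insert_erase hk, hE]
      dsimp only
      rw [s1, erase_insert hkJ, s4, neg_mul, smul_mul_assoc, mul_assoc _ (T 1 2 (v k)), s5,
        g_swap c (v j) (v k)]
      simp only [smul_smul, smul_mul_assoc, mul_smul_comm, neg_mul, smul_neg, mul_assoc, neg_smul]
      congr 2
      ring
    rw [e2, ← smul_sum, ← sum_mul, ← sum_mul, sum_neg_distrib]
    simp only [mul_smul_comm, ← mul_assoc]
    rw [e1]
    simp only [sub_mul, neg_mul, smul_mul_assoc, smul_sub, smul_neg, smul_smul]
    simp only [hF, hG, hD, ← mul_assoc, sub_eq_add_neg]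
  have hB : ∑ i ∈ I, (g c (v j) (u i) * (∏ i' ∈ I.erase i, f c (u i) (u i')) *
        ∏ l ∈ J, f c (v l) (u i)) • (T 0 2 (v j) * Y c T u v (I.erase i) J * T 1 1 (u i)) =
      ∑ α ∈ I.powerset, ∑ β ∈ J.powerset, ∑ i ∈ α, (g c (v j) (u i) *
        (∏ i' ∈ α.erase i, f c (u i) (u i')) * (∏ l ∈ β, f c (v l) (u i)) *
        (∏ l ∈ J \ β, f c (v l) (u i)) * KSet c u v β (α.erase i) * F α * G β) • E β α := by
    have e1 : ∀ i ∈ I, (g c (v j) (u i) * (∏ i' ∈ I.erase i, f c (u i) (u i')) *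
        ∏ l ∈ J, f c (v l) (u i)) • (T 0 2 (v j) * Y c T u v (I.erase i) J * T 1 1 (u i)) =
        ∑ α ∈ (I.erase i).powerset, ∑ β ∈ J.powerset, (g c (v j) (u i) *
          (∏ i' ∈ α, f c (u i) (u i')) * (∏ l ∈ β, f c (v l) (u i)) *
          (∏ l ∈ J \ β, f c (v l) (u i)) * KSet c u v β α * F (insert i α) * G β) •
          E β (insert i α) := by
      intro i hi
      rw [Y_eq_sum, mul_sum, sum_mul, smul_sum]
      refine sum_congr rfl fun α hα => ?_
      rw [mul_sum, sum_mul, smul_sum]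
      refine sum_congr rfl fun β hβ => ?_
      rw [mem_powerset] at hα hβ
      have hiα : i ∉ α := fun hm => notMem_erase i I (hα hm)
      have s1 : I.erase i \ α = I \ insert i α := by
        rw [sdiff_insert, erase_sdiff_comm]
      have s2 : F (insert i α) = (∏ i' ∈ I.erase i \ α, f c (u i) (u i')) *
          ∏ a ∈ α, ∏ i' ∈ I.erase i \ α, f c (u a) (u i') := by
        simp only [hF]
        rw [prod_insert hiα, s1]
      have s3 : opProd (T 1 1) u (insert i α) = opProd (T 1 1) u α * T 1 1 (u i) :=
        opProd_insert _ (hT.commute_same (by decide) (by decide)) u hiα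
      rw [s2, ← prod_sdiff hα, ← prod_sdiff hβ]
      simp only [hE, hD]
      rw [s3, s1]
      simp only [smul_smul, smul_mul_assoc, mul_smul_comm, mul_assoc]
      congr 1
      simp only [hG]
      ring
    rw [sum_congr rfl e1, sum_sum_powerset_erase I (fun i α => ∑ β ∈ J.powerset, (g c (v j) (u i) *
          (∏ i' ∈ α, f c (u i) (u i')) * (∏ l ∈ β, f c (v l) (u i)) *
          (∏ l ∈ J \ β, f c (v l) (u i)) * KSet c u v β α * F (insert i α) * G β) •
          E β (insert i α))]
    refine sum_congr rfl fun α _ => ?_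
    rw [sum_comm]
    refine sum_congr rfl fun β _ => sum_congr rfl fun i hi => ?_
    rw [insert_erase hi]
  rw [hL, hA, hB, add_assoc]
  congr 1
  rw [← sum_add_distrib]
  refine sum_congr rfl fun α _ => ?_
  rw [← sum_add_distrib]
  refine sum_congr rfl fun β hβ => ?_
  rw [mem_powerset] at hβ
  rw [← sum_smul, ← sum_smul, ← add_smul]
  congr 1
  -- Only the coefficients of `E β α` remain, and they differ from this expansion by the common
  -- factor `F α * G β`.
  have key := prod_f_mul_KSet_insert c hc u v j β (J \ β) α (fun hm => hjJ (hβ hm))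
    (fun hm => hjJ (mem_sdiff.1 hm).1) disjoint_sdiff hu hv huv hvu
  simp only [← sum_mul]
  linear_combination F α * G β * key

end Recursion

/-! ### Rational identities for the action formulas -/

section ScalarIdentities

theorem f_mul_g_sub {c x y z : ℂ} (hxy : x ≠ y) (hxz : x ≠ z) (hyz : y ≠ z) :
    f c x y * g c x z - g c x y * g c y z = g c x z * f c z y := by
  have := sub_ne_zero.2 hxy
  have := sub_ne_zero.2 hxz
  have := sub_ne_zero.2 hyz
  unfold f
  rw [g_swap c y z]
  unfold g
  field_simp
  ring

theorem g_mul_f_sub {c x y z : ℂ} (hxy : x ≠ y) (hxz : x ≠ z) (hyz : y ≠ z) :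
    g c z y * f c x y = f c x z * g c z y - g c x z * g c x y := by
  have := sub_ne_zero.2 hxy
  have := sub_ne_zero.2 hxz
  have := sub_ne_zero.2 hyz
  unfold f
  rw [g_swap c y z]
  unfold g
  field_simp
  ring

theorem f_mul_f_mul_g {c x y z : ℂ} (hxy : x ≠ y) (hxz : x ≠ z) (hyz : y ≠ z) :
    f c z y * f c x z * g c x y - g c z y * f c x y * g c x z = g c x y := by
  have := sub_ne_zero.2 hxy
  have := sub_ne_zero.2 hxz
  have := sub_ne_zero.2 hyz
  unfold f
  rw [g_swap c y z]
  unfold g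
  field_simp
  ring

/-- The two coefficients of the terms with both `y` and `w` removed agree only after symmetrization
in `y` and `w`. -/
theorem g_f_g_symm {c x z y w : ℂ} (hxz : x ≠ z) (hxy : x ≠ y) (hxw : x ≠ w) (hzy : z ≠ y)
    (hzw : z ≠ w) (hyw : y ≠ w) :
    g c x y * f c y w * g c z w + g c x w * f c w y * g c z y =
      g c z y * f c y w * f c x y * g c x w * f c w z +
        g c z w * f c w y * f c x w * g c x y * f c y z := by
  have := sub_ne_zero.2 hxy
  have := sub_ne_zero.2 hxz
  have := sub_ne_zero.2 hzy
  have := sub_ne_zero.2 hxw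
  have := sub_ne_zero.2 hzw
  have := sub_ne_zero.2 hyw
  unfold f
  rw [g_swap c z w, g_swap c z y, g_swap c y w]
  unfold g
  field_simp
  ring

theorem sum_sum_erase_eq_of_symm {A σ : Type*} [AddCommGroup A] [Module ℂ A] [DecidableEq σ]
    (U : Finset σ) (φ ψ : σ → σ → A)
    (hφ : ∀ y ∈ U, ∀ w ∈ U, y ≠ w → φ y w + φ w y = ψ y w + ψ w y) :
    ∑ y ∈ U, ∑ w ∈ U.erase y, φ y w = ∑ y ∈ U, ∑ w ∈ U.erase y, ψ y w := by
  have hsw : ∀ χ : σ → σ → A, ∑ y ∈ U, ∑ w ∈ U.erase y, χ y w =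
      ∑ y ∈ U, ∑ w ∈ U.erase y, χ w y := fun χ => sum_comm' fun y w => by
    simp only [mem_erase, ne_eq]
    tauto
  have h2 : (2 : ℂ) • ∑ y ∈ U, ∑ w ∈ U.erase y, φ y w =
      (2 : ℂ) • ∑ y ∈ U, ∑ w ∈ U.erase y, ψ y w := by
    rw [two_smul, two_smul]
    conv_lhs => arg 2; rw [hsw φ]
    conv_rhs => arg 2; rw [hsw ψ]
    rw [← sum_add_distrib, ← sum_add_distrib]
    refine sum_congr rfl fun y hy => ?_
    rw [← sum_add_distrib, ← sum_add_distrib]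
    exact sum_congr rfl fun w hw => hφ y hy w (mem_of_mem_erase hw) (ne_of_mem_erase hw).symm
  exact smul_right_injective A (two_ne_zero (α := ℂ)) h2

end ScalarIdentities

/-! ### Action of `T_{12}` and `T_{22}` when one variable is added -/

section Action

variable {A : Type*} [Ring A]

/-- The product of the operators `O y`, `y ∈ U`. -/
def opSet (O : ℂ → A) (U : Finset ℂ) : A := (U.toList.map O).prod

theorem opSet_insert (O : ℂ → A) (hO : ∀ x y, Commute (O x) (O y)) {z : ℂ} {U : Finset ℂ}
    (hz : z ∉ U) : opSet O (insert z U) = O z * opSet O U := by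
  have h1 : ((insert z U).toList.map O).Perm ((z :: U.toList).map O) := (toList_insert hz).map O
  have h2 : ((insert z U).toList.map O).Pairwise Commute := by
    rw [List.pairwise_map]
    exact List.pairwise_of_forall fun _ _ => hO _ _
  rw [opSet, h1.prod_eq' h2, List.map_cons, List.prod_cons, opSet]

theorem opProd_eq_opSet {ι : Type*} [LinearOrder ι] (O : ℂ → A) (hO : ∀ x y, Commute (O x) (O y)) {u : ι → ℂ}
    (hu : Function.Injective u) (I : Finset ι) : opProd O u I = opSet O (I.image u) := by
  induction I using Finset.induction_on with
  | empty => simp [opProd, opSet]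
  | insert i I hi ih =>
    have h1 : u i ∉ I.image u := by simpa [hu.eq_iff] using hi
    rw [image_insert, opSet_insert O hO h1, opProd_insert O hO u hi, ih, opSet]
    exact ((Commute.list_prod_right _ _ fun x hx => by
      obtain ⟨y, -, rfl⟩ := List.mem_map.1 hx
      exact hO _ _).eq).symm

variable [Algebra ℂ A]

/-- The step of the recursion for the off-shell vectors which adds the variable `x`. -/
def addVar (c : ℂ) (T : Fin 3 → Fin 3 → ℂ → A) (x : ℂ) (k : ℂ → ℂ) (G : Finset ℂ → A)
    (U : Finset ℂ) : A :=
  T 1 2 x * G U + ∑ y ∈ U, (g c x y * (∏ y' ∈ U.erase y, f c y y') * k y) •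
    (T 0 2 x * G (U.erase y) * T 1 1 y)

/-- The action of `T_{12}(z)` on `G(U)`, with the unwanted term `T_{13}(z) Z(z, U)`. -/
def ActT01 (T : Fin 3 → Fin 3 → ℂ → A) (G : Finset ℂ → A) (Z : ℂ → Finset ℂ → A) (z : ℂ)
    (U : Finset ℂ) : Prop :=
  T 0 1 z * G U = G (insert z U) - T 0 2 z * Z z U

/-- The action of `T_{22}(z)` on `G(U)`, with the unwanted term `T_{23}(z) Z(z, U)`. -/
def ActT11 (c : ℂ) (T : Fin 3 → Fin 3 → ℂ → A) (k : ℂ → ℂ) (G : Finset ℂ → A)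
    (Z : ℂ → Finset ℂ → A) (z : ℂ) (U : Finset ℂ) : Prop :=
  T 1 1 z * G U = ((∏ y ∈ U, f c z y) * k z) • (G U * T 1 1 z) -
    ∑ y ∈ U, (g c z y * (∏ y' ∈ U.erase y, f c y y') * k y) • (G (insert z (U.erase y)) * T 1 1 y) -
    T 1 2 z * Z z U

/-- The unwanted term after the addition of the variable `x`. -/
def addVarUnwanted (c : ℂ) (T : Fin 3 → Fin 3 → ℂ → A) (x : ℂ) (k : ℂ → ℂ) (G : Finset ℂ → A)
    (Z : ℂ → Finset ℂ → A) (z : ℂ) (U : Finset ℂ) : A :=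
  (g c x z * h c z x) • addVar c T x k (Z z) U +
    g c x z • (((∏ y ∈ U, f c x y) * k x) • (G U * T 1 1 x) - addVar c T x k (Z x) U)

variable {c : ℂ} {T : Fin 3 → Fin 3 → ℂ → A}

theorem IsRTT.actT01_opSet (hT : IsRTT c T) {z : ℂ} {U : Finset ℂ} (hz : z ∉ U) :
    ActT01 T (opSet (T 0 1)) 0 z U := by
  simp [ActT01, opSet_insert _ (hT.commute_same (i := 0) (j := 1) (by decide) (by decide)) hz]

theorem IsRTT.actT11_opSet (hT : IsRTT c T) {z : ℂ} {U : Finset ℂ} (hz : z ∉ U) :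
    ActT11 c T 1 (opSet (T 0 1)) 0 z U := by
  have hc := hT.commute_same (i := 0) (j := 1) (by decide) (by decide)
  simp only [ActT11, Pi.one_apply, mul_one, Pi.zero_apply, mul_zero, sub_zero]
  induction U using Finset.induction_on generalizing z with
  | empty => simp [opSet]
  | insert w U hw ih =>
    have hzw : z ≠ w := fun e => hz (e ▸ mem_insert_self _ _)
    have hzU : z ∉ U := fun h' => hz (mem_insert_of_mem h')
    have s1 : ∑ y ∈ U, (g c z y * ∏ y' ∈ (insert w U).erase y, f c y y') •
        (opSet (T 0 1) (insert z ((insert w U).erase y)) * T 1 1 y) =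
        f c z w • (T 0 1 w * ∑ y ∈ U, (g c z y * ∏ y' ∈ U.erase y, f c y y') •
          (opSet (T 0 1) (insert z (U.erase y)) * T 1 1 y)) -
        g c z w • (T 0 1 z * ∑ y ∈ U, (g c w y * ∏ y' ∈ U.erase y, f c y y') •
          (opSet (T 0 1) (insert w (U.erase y)) * T 1 1 y)) := by
      simp only [mul_sum, smul_sum]
      rw [← sum_sub_distrib]
      refine sum_congr rfl fun y hy => ?_
      have hyw : y ≠ w := fun e => hw (e ▸ hy)
      have hzy : z ≠ y := fun e => hzU (e ▸ hy)
      have hwU : w ∉ U.erase y := fun h' => hw (mem_of_mem_erase h')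
      have hzU' : z ∉ U.erase y := fun h' => hzU (mem_of_mem_erase h')
      have hwz : z ∉ insert w (U.erase y) := by
        rw [mem_insert]
        tauto
      rw [erase_insert_of_ne hyw.symm, prod_insert hwU, opSet_insert _ hc hwz,
        opSet_insert _ hc hwU, opSet_insert _ hc hzU']
      have e1 := f_mul_g_sub (c := c) hzw hzy hyw.symm
      have e2 := hc w z
      simp only [mul_smul_comm, smul_smul, ← mul_assoc]
      rw [e2.eq, ← sub_smul]
      congr 1
      linear_combination -(∏ y' ∈ U.erase y, f c y y') * e1
    rw [sum_insert hw, erase_insert hw, prod_insert hw, s1, opSet_insert _ hc hw, ← mul_assoc,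
      hT.T11_mul_T01 hzw, sub_mul, smul_mul_assoc, smul_mul_assoc, mul_assoc, mul_assoc, ih hzU,
      ih hw, opSet_insert _ hc hzU]
    simp only [mul_sub, mul_smul_comm, mul_assoc]
    module

/-- This bracket multiplies `-g(x, z) T_{13}(z)` in one action and `-g(x, z) T_{23}(z)` in the
other, which is why both share one unwanted term. In its evaluation the vectors with `x` in place of
`y` cancel. -/
theorem addVar_sub_bracket {x : ℂ} {k : ℂ → ℂ} {G : Finset ℂ → A} {Z : ℂ → Finset ℂ → A}
    {U : Finset ℂ} (h1 : ∀ y ∈ U, ActT01 T G Z x (U.erase y)) (h2 : ActT11 c T k G Z x U) :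
    T 1 1 x * G U + ∑ y ∈ U, (g c x y * (∏ y' ∈ U.erase y, f c y y') * k y) •
      (T 0 1 x * G (U.erase y) * T 1 1 y) =
    ((∏ y ∈ U, f c x y) * k x) • (G U * T 1 1 x) - addVar c T x k (Z x) U := by
  have h3 : ∑ y ∈ U, (g c x y * (∏ y' ∈ U.erase y, f c y y') * k y) •
      (T 0 1 x * G (U.erase y) * T 1 1 y) =
      ∑ y ∈ U, (g c x y * (∏ y' ∈ U.erase y, f c y y') * k y) •
        (G (insert x (U.erase y)) * T 1 1 y) -
      ∑ y ∈ U, (g c x y * (∏ y' ∈ U.erase y, f c y y') * k y) •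
        (T 0 2 x * Z x (U.erase y) * T 1 1 y) := by
    rw [← sum_sub_distrib]
    refine sum_congr rfl fun y hy => ?_
    rw [h1 y hy, sub_mul, smul_sub]
  rw [h3, h2, addVar]
  module

/-- The action of `T_{12}(z)` after the addition of a variable. -/
theorem IsRTT.actT01_addVar (hT : IsRTT c T) (hc : c ≠ 0) {x z : ℂ} {k : ℂ → ℂ}
    {G : Finset ℂ → A} {Z : ℂ → Finset ℂ → A} {U : Finset ℂ} (hxz : x ≠ z) (hx : x ∉ U)
    (hz : z ∉ U) (h1z : ActT01 T G Z z U) (h1z' : ∀ y ∈ U, ActT01 T G Z z (U.erase y))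
    (h1x : ∀ y ∈ U, ActT01 T G Z x (U.erase y))
    (h2z : ActT11 c T k G Z z U) (h2x : ActT11 c T k G Z x U) :
    ActT01 T (addVar c T x k G) (addVarUnwanted c T x k G Z) z U := by
  set cf : ℂ → ℂ := fun y => g c x y * (∏ y' ∈ U.erase y, f c y y') * k y with hcf
  have hbr : T 1 1 x * G U + ∑ y ∈ U, cf y • (T 0 1 x * G (U.erase y) * T 1 1 y) =
      ((∏ y ∈ U, f c x y) * k x) • (G U * T 1 1 x) - addVar c T x k (Z x) U :=
    addVar_sub_bracket h1x h2x
  rw [ActT01, addVarUnwanted, ← hbr]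
  have hEx := hT.exchange hc (i := 0) (by decide) hxz
  have hN : T 0 1 z * (T 1 2 x * G U) = T 1 2 x * (T 0 1 z * G U) +
      g c x z • (T 0 2 x * (T 1 1 z * G U)) - g c x z • (T 0 2 z * (T 1 1 x * G U)) := by
    rw [← mul_assoc, hT.T01_mul_T12 hxz]
    simp only [add_mul, sub_mul, smul_mul_assoc, mul_assoc]
  have hR : addVar c T x k G (insert z U) = T 1 2 x * G (insert z U) +
      (g c x z * (∏ y ∈ U, f c z y) * k z) • (T 0 2 x * G U * T 1 1 z) +
      ∑ y ∈ U, (cf y * f c y z) • (T 0 2 x * G (insert z (U.erase y)) * T 1 1 y) := by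
    rw [addVar, sum_insert hz, erase_insert hz, add_assoc]
    congr 2
    refine sum_congr rfl fun y hy => ?_
    have hyz : z ≠ y := fun e => hz (e ▸ hy)
    rw [erase_insert_of_ne hyz, prod_insert (fun h' => hz (mem_of_mem_erase h'))]
    congr 1
    simp only [hcf]
    ring
  have hS : ∑ y ∈ U, cf y • (T 0 1 z * (T 0 2 x * G (U.erase y) * T 1 1 y)) =
      g c x z • (T 0 2 x * ∑ y ∈ U, (g c z y * (∏ y' ∈ U.erase y, f c y y') * k y) •
        (G (insert z (U.erase y)) * T 1 1 y)) +
      ∑ y ∈ U, (cf y * f c y z) • (T 0 2 x * G (insert z (U.erase y)) * T 1 1 y) -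
      T 0 2 z * ((g c x z * h c z x) • ∑ y ∈ U, cf y • (T 0 2 x * Z z (U.erase y) * T 1 1 y)) -
      T 0 2 z * (g c x z • ∑ y ∈ U, cf y • (T 0 1 x * G (U.erase y) * T 1 1 y)) := by
    simp only [mul_sum, smul_sum]
    rw [← sum_add_distrib, ← sum_sub_distrib, ← sum_sub_distrib]
    refine sum_congr rfl fun y hy => ?_
    have hxy : x ≠ y := fun e => hx (e ▸ hy)
    have hzy : z ≠ y := fun e => hz (e ▸ hy)
    have e1 : T 0 1 z * (T 0 2 x * G (U.erase y) * T 1 1 y) =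
        f c x z • (T 0 2 x * (T 0 1 z * G (U.erase y)) * T 1 1 y) -
          g c x z • (T 0 2 z * (T 0 1 x * G (U.erase y)) * T 1 1 y) := by
      rw [← mul_assoc, ← mul_assoc, hT.T01_mul_T02 hxz]
      simp only [sub_mul, smul_mul_assoc, mul_assoc]
    have e2 : f c x z • (T 0 2 x * (T 0 2 z * Z z (U.erase y)) * T 1 1 y) =
        (g c x z * h c z x) • (T 0 2 z * (T 0 2 x * Z z (U.erase y) * T 1 1 y)) := by
      have := congrArg (fun t => g c x z • (t * (Z z (U.erase y) * T 1 1 y))) hEx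
      simp only [smul_mul_assoc, smul_smul, mul_assoc] at this ⊢
      rw [f_eq_g_mul_h hc hxz, this]
    have e3 := f_mul_g_sub (c := c) hxz hxy hzy
    rw [e1, h1z' y hy, mul_sub, sub_mul, smul_sub, smul_sub, e2]
    simp only [mul_smul_comm, ← mul_assoc]
    match_scalars
    · simp only [hcf]
      linear_combination ((∏ y' ∈ U.erase y, f c y y') * k y) * e3
    · ring
    · ring
  have hM : T 1 2 x * (T 0 2 z * Z z U) = (g c x z * h c z x) • (T 0 2 z * (T 1 2 x * Z z U)) -
      g c x z • (T 0 2 x * (T 1 2 z * Z z U)) := by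
    rw [← mul_assoc, hT.T12_mul_T02 hc hxz.symm]
    simp only [sub_mul, smul_mul_assoc, mul_assoc]
  have hZz : addVar c T x k (Z z) U = T 1 2 x * Z z U +
      ∑ y ∈ U, cf y • (T 0 2 x * Z z (U.erase y) * T 1 1 y) := rfl
  rw [hR]
  conv_lhs => rw [addVar, mul_add, hN, h1z, h2z, mul_sum]
  simp only [mul_smul_comm]
  rw [hS, hZz]
  simp only [mul_sub, mul_add, hM, smul_add, mul_smul_comm, mul_assoc]
  module

/-- The action of `T_{22}(z)` after the addition of a variable. -/
theorem IsRTT.actT11_addVar (hT : IsRTT c T) (hc : c ≠ 0) {x z : ℂ} {k : ℂ → ℂ}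
    {G : Finset ℂ → A} {Z : ℂ → Finset ℂ → A} {U : Finset ℂ} (hxz : x ≠ z) (hx : x ∉ U)
    (hz : z ∉ U) (h1z : ∀ y ∈ U, ActT01 T G Z z (U.erase y))
    (h1x : ∀ y ∈ U, ActT01 T G Z x (U.erase y))
    (h2z : ActT11 c T k G Z z U) (h2z' : ∀ y ∈ U, ActT11 c T k G Z z (U.erase y))
    (h2x : ActT11 c T k G Z x U) :
    ActT11 c T (fun y => f c x y * k y) (addVar c T x k G) (addVarUnwanted c T x k G Z) z U := by
  set p : ℂ → ℂ := fun y => (∏ y' ∈ U.erase y, f c y y') * k y with hp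
  have hcT := hT.commute_same (i := 1) (j := 1) (by decide) (by decide)
  have hbr : T 1 1 x * G U + ∑ y ∈ U, (g c x y * p y) • (T 0 1 x * G (U.erase y) * T 1 1 y) =
      ((∏ y ∈ U, f c x y) * k x) • (G U * T 1 1 x) - addVar c T x k (Z x) U := by
    rw [← addVar_sub_bracket h1x h2x]
    simp only [hp, mul_assoc]
  have hadd : ∀ G : Finset ℂ → A, addVar c T x k G U = T 1 2 x * G U +
      ∑ y ∈ U, (g c x y * p y) • (T 0 2 x * G (U.erase y) * T 1 1 y) := by
    intro G
    simp only [addVar, hp, mul_assoc]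
  have h2z0 : T 1 1 z * G U = ((∏ y ∈ U, f c z y) * k z) • (G U * T 1 1 z) -
      ∑ y ∈ U, (g c z y * p y) • (G (insert z (U.erase y)) * T 1 1 y) - T 1 2 z * Z z U := by
    rw [h2z]
    simp only [hp, mul_assoc]
  have hEx := hT.exchange hc (i := 1) (by decide) hxz
  have hN : T 1 1 z * (T 1 2 x * G U) = f c x z • (T 1 2 x * (T 1 1 z * G U)) -
      g c x z • (T 1 2 z * (T 1 1 x * G U)) := by
    rw [← mul_assoc, hT.T11_mul_T12 hxz]
    simp only [sub_mul, smul_mul_assoc, mul_assoc]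
  have hM : f c x z • (T 1 2 x * (T 1 2 z * Z z U)) =
      (g c x z * h c z x) • (T 1 2 z * (T 1 2 x * Z z U)) := by
    have := congrArg (fun t => g c x z • (t * Z z U)) hEx
    simp only [smul_mul_assoc, smul_smul, mul_assoc] at this ⊢
    rw [f_eq_g_mul_h hc hxz, this]
  have hM' : T 0 2 x * T 1 2 z + g c x z • (T 1 2 x * T 0 2 z) =
      (g c x z * h c z x) • (T 1 2 z * T 0 2 x) := by
    rw [g_mul_h_swap hc hxz.symm]
    have := hT.relation_odd hxz (i := 0) (k := 1) (by decide) (by decide)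
    linear_combination (norm := module) this
  -- the vectors with `z` and without two elements of `U`
  have hR : ∀ y ∈ U, addVar c T x k G (insert z (U.erase y)) = T 1 2 x * G (insert z (U.erase y)) +
      (g c x z * (∏ w ∈ U.erase y, f c z w) * k z) • (T 0 2 x * G (U.erase y) * T 1 1 z) +
      ∑ w ∈ U.erase y, (g c x w * f c w z * (∏ y' ∈ (U.erase y).erase w, f c w y') * k w) •
        (T 0 2 x * G (insert z ((U.erase y).erase w)) * T 1 1 w) := by
    intro y hy
    have hzy : z ∉ U.erase y := fun h' => hz (mem_of_mem_erase h')
    rw [addVar, sum_insert hzy, erase_insert hzy, add_assoc]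
    congr 2
    refine sum_congr rfl fun w hw => ?_
    have hwz : z ≠ w := fun e => hzy (e ▸ hw)
    rw [erase_insert_of_ne hwz, prod_insert (fun h' => hzy (mem_of_mem_erase h'))]
    congr 1
    ring
  -- The operators are symmetric in `y` and `w` because the `T_{22}` commute, so it suffices to
  -- compare symmetrized coefficients.
  have hD : ∑ y ∈ U, ∑ w ∈ U.erase y, (g c x y * p y * (g c z w *
      (∏ y' ∈ (U.erase y).erase w, f c w y') * k w)) •
        (T 0 2 x * G (insert z ((U.erase y).erase w)) * T 1 1 w * T 1 1 y) =
      ∑ y ∈ U, ∑ w ∈ U.erase y, (g c z y * f c x y * p y * (g c x w * f c w z *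
        (∏ y' ∈ (U.erase y).erase w, f c w y') * k w)) •
        (T 0 2 x * G (insert z ((U.erase y).erase w)) * T 1 1 w * T 1 1 y) := by
    refine sum_sum_erase_eq_of_symm U _ _ fun y hy w hw hyw => ?_
    have e1 : (U.erase w).erase y = (U.erase y).erase w := erase_right_comm
    have e2 : p y = f c y w * (∏ y' ∈ (U.erase y).erase w, f c y y') * k y := by
      simp only [hp]
      rw [mul_prod_erase _ (fun y' => f c y y') (mem_erase.2 ⟨hyw.symm, hw⟩)]
    have e3 : p w = f c w y * (∏ y' ∈ (U.erase y).erase w, f c w y') * k w := by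
      simp only [hp]
      rw [← e1, mul_prod_erase _ (fun y' => f c w y') (mem_erase.2 ⟨hyw, hy⟩)]
    have e4 : T 0 2 x * G (insert z ((U.erase y).erase w)) * T 1 1 y * T 1 1 w =
        T 0 2 x * G (insert z ((U.erase y).erase w)) * T 1 1 w * T 1 1 y := by
      rw [mul_assoc, (hcT y w).eq, ← mul_assoc]
    have e5 := g_f_g_symm (c := c) hxz (fun e => hx (e ▸ hy)) (fun e => hx (e ▸ hw))
      (fun e => hz (e ▸ hy)) (fun e => hz (e ▸ hw)) hyw
    rw [e1, e4, e2, e3, ← add_smul, ← add_smul]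
    congr 1
    linear_combination ((∏ y' ∈ (U.erase y).erase w, f c y y') * k y *
      (∏ y' ∈ (U.erase y).erase w, f c w y') * k w) * e5
  have hS : ∑ y ∈ U, (g c x y * p y) • (T 1 1 z * (T 0 2 x * G (U.erase y) * T 1 1 y)) =
      ((∏ y ∈ U, f c z y) * (f c x z * k z)) •
        ((∑ y ∈ U, (g c x y * p y) • (T 0 2 x * G (U.erase y) * T 1 1 y)) * T 1 1 z) -
      ∑ y ∈ U, (g c z y * f c x y * p y) • (addVar c T x k G (insert z (U.erase y)) * T 1 1 y) +
      f c x z • (T 1 2 x * ∑ y ∈ U, (g c z y * p y) • (G (insert z (U.erase y)) * T 1 1 y)) -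
      T 1 2 z * ((g c x z * h c z x) •
        ∑ y ∈ U, (g c x y * p y) • (T 0 2 x * Z z (U.erase y) * T 1 1 y)) -
      T 1 2 z * (g c x z • ∑ y ∈ U, (g c x y * p y) • (T 0 1 x * G (U.erase y) * T 1 1 y)) := by
    have hR' : ∑ y ∈ U, (g c z y * f c x y * p y) •
        (addVar c T x k G (insert z (U.erase y)) * T 1 1 y) =
        ∑ y ∈ U, ((g c z y * f c x y * p y) • (T 1 2 x * G (insert z (U.erase y)) * T 1 1 y) +
          (g c z y * f c x y * p y * (g c x z * (∏ w ∈ U.erase y, f c z w) * k z)) •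
            (T 0 2 x * G (U.erase y) * T 1 1 y * T 1 1 z)) +
        ∑ y ∈ U, ∑ w ∈ U.erase y, (g c z y * f c x y * p y * (g c x w * f c w z *
          (∏ y' ∈ (U.erase y).erase w, f c w y') * k w)) •
          (T 0 2 x * G (insert z ((U.erase y).erase w)) * T 1 1 w * T 1 1 y) := by
      rw [← sum_add_distrib]
      refine sum_congr rfl fun y hy => ?_
      rw [hR y hy, add_mul, add_mul, smul_add, smul_add, smul_mul_assoc, smul_smul, sum_mul,
        smul_sum, mul_assoc (T 0 2 x * G (U.erase y)), (hcT z y).eq, ← mul_assoc (T 0 2 x * G (U.erase y))]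
      simp only [smul_mul_assoc, smul_smul]
    rw [hR', ← hD]
    simp only [mul_sum, sum_mul, smul_sum]
    simp only [← sum_add_distrib, ← sum_sub_distrib]
    refine sum_congr rfl fun y hy => ?_
    have hxy : x ≠ y := fun e => hx (e ▸ hy)
    have hyz : y ≠ z := fun e => hz (e ▸ hy)
    have e1 : T 1 1 z * (T 0 2 x * G (U.erase y) * T 1 1 y) =
        T 0 2 x * (T 1 1 z * G (U.erase y)) * T 1 1 y +
          g c x z • (T 1 2 x * (T 0 1 z * G (U.erase y)) * T 1 1 y) -
          g c x z • (T 1 2 z * (T 0 1 x * G (U.erase y)) * T 1 1 y) := by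
      rw [← mul_assoc, ← mul_assoc, hT.T11_mul_T02 hxz]
      simp only [add_mul, sub_mul, smul_mul_assoc, mul_assoc]
    have e2 : T 0 2 x * (T 1 2 z * Z z (U.erase y)) * T 1 1 y +
        g c x z • (T 1 2 x * (T 0 2 z * Z z (U.erase y)) * T 1 1 y) =
        (g c x z * h c z x) • (T 1 2 z * (T 0 2 x * Z z (U.erase y) * T 1 1 y)) := by
      have := congrArg (fun t => t * (Z z (U.erase y) * T 1 1 y)) hM'
      simpa only [add_mul, smul_mul_assoc, mul_assoc] using this
    have e3 : (g c x y * p y) • (T 0 2 x * (∑ w ∈ U.erase y, (g c z w *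
        (∏ y' ∈ (U.erase y).erase w, f c w y') * k w) •
        (G (insert z ((U.erase y).erase w)) * T 1 1 w)) * T 1 1 y) =
        ∑ w ∈ U.erase y, (g c x y * p y * (g c z w *
          (∏ y' ∈ (U.erase y).erase w, f c w y') * k w)) •
          (T 0 2 x * G (insert z ((U.erase y).erase w)) * T 1 1 w * T 1 1 y) := by
      rw [mul_sum, sum_mul, smul_sum]
      refine sum_congr rfl fun w _ => ?_
      rw [mul_smul_comm, smul_mul_assoc, smul_smul]
      simp only [mul_assoc]
    have e4 : T 0 2 x * (G (U.erase y) * T 1 1 z) * T 1 1 y =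
        T 0 2 x * G (U.erase y) * T 1 1 y * T 1 1 z := by
      simp only [mul_assoc]
      rw [(hcT z y).eq]
    have e5 : (p y * (∏ w ∈ U.erase y, f c z w) * k z *
        (f c z y * f c x z * g c x y - g c z y * f c x y * g c x z)) •
          (T 0 2 x * G (U.erase y) * T 1 1 y * T 1 1 z) =
        (p y * (∏ w ∈ U.erase y, f c z w) * k z * g c x y) •
          (T 0 2 x * G (U.erase y) * T 1 1 y * T 1 1 z) := by
      rw [f_mul_f_mul_g hxy hxz hyz]
    have e6 : (p y * (g c z y * f c x y)) • (T 1 2 x * G (insert z (U.erase y)) * T 1 1 y) =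
        (p y * (f c x z * g c z y - g c x z * g c x y)) •
          (T 1 2 x * G (insert z (U.erase y)) * T 1 1 y) := by
      rw [g_mul_f_sub hxy hxz hyz]
    rw [e1, h2z' y hy, h1z y hy, ← mul_prod_erase U (fun w => f c z w) hy, ← e3]
    simp only [mul_sub, sub_mul, mul_smul_comm, smul_mul_assoc]
    rw [e4]
    simp only [← mul_assoc] at e2 e5 e6 ⊢
    linear_combination (norm := module) e6 - (g c x y * p y) • e2 - e5
  have hsum : ∑ y ∈ U, (g c z y * (∏ y' ∈ U.erase y, f c y y') * (f c x y * k y)) •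
      (addVar c T x k G (insert z (U.erase y)) * T 1 1 y) =
      ∑ y ∈ U, (g c z y * f c x y * p y) •
        (addVar c T x k G (insert z (U.erase y)) * T 1 1 y) := by
    refine sum_congr rfl fun y _ => ?_
    simp only [hp]
    congr 1
    ring
  rw [ActT11, addVarUnwanted, ← hbr, hsum, hadd G, hadd (Z z), mul_add, hN, h2z0, mul_sum]
  simp only [mul_smul_comm]
  rw [hS]
  simp only [mul_sub, mul_add, add_mul, smul_add, smul_sub, mul_smul_comm, mul_assoc, hM]
  module

end Action

/-! ### Off-shell vectors, their unwanted terms, and the identification with `Y` -/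

section OffShell

variable {A : Type*} [Ring A] [Algebra ℂ A] {κ : Type*} [LinearOrder κ]

/-- The off-shell vector for the list `l` of `v`-variables, without the normalization by `h`. -/
def offShellList (c : ℂ) (T : Fin 3 → Fin 3 → ℂ → A) : List ℂ → Finset ℂ → A
  | [] => opSet (T 0 1)
  | x :: l => addVar c T x (fun y => (l.map fun t => f c t y).prod) (offShellList c T l)

/-- The off-shell vector for the variables `v_j`, `j ∈ J`, in increasing order. -/
def offShell (c : ℂ) (T : Fin 3 → Fin 3 → ℂ → A) (v : κ → ℂ) (J : Finset κ) : Finset ℂ → A :=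
  offShellList c T ((J.sort (· ≤ ·)).map v)

/-- The coefficient of the unwanted term with the variable `v_ρ`. -/
def unwantedCoeff (c : ℂ) (v : κ → ℂ) (J : Finset κ) (ρ : κ) : ℂ :=
  ∏ l ∈ J.erase ρ, if ρ < l then f c (v l) (v ρ) else -f c (v ρ) (v l)

/-- The unwanted terms in the action of `T_{12}(z)` and `T_{22}(z)` on off-shell vectors. -/
def unwanted (c : ℂ) (T : Fin 3 → Fin 3 → ℂ → A) (v : κ → ℂ) (J : Finset κ) (z : ℂ)
    (U : Finset ℂ) : A :=
  ∑ ρ ∈ J, (unwantedCoeff c v J ρ * g c (v ρ) z * ∏ y ∈ U, f c (v ρ) y) •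
    (offShell c T v (J.erase ρ) U * T 1 1 (v ρ))

variable {c : ℂ} {T : Fin 3 → Fin 3 → ℂ → A} {v : κ → ℂ}

theorem offShell_empty : offShell c T v ∅ = opSet (T 0 1) := by
  simp [offShell, offShellList]

theorem offShell_insert_min {J : Finset κ} {j : κ} (hj : ∀ l ∈ J, j < l) :
    offShell c T v (insert j J) =
      addVar c T (v j) (fun y => ∏ l ∈ J, f c (v l) y) (offShell c T v J) := by
  rw [offShell, sort_insert _ (fun b hb => (hj b hb).le) (fun hm => (hj j hm).false), List.map_cons,
    offShellList, offShell]
  congr 1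
  funext y
  rw [List.map_map, ← Multiset.prod_coe, ← Multiset.map_coe, sort_eq]
  rfl

/-- Adding a variable acts on each `ρ` separately: the factor `f(v_ρ, y)` missing from the product
over `U.erase y` is supplied by the product over `J`, and the `T_{22}` commute. -/
theorem IsRTT.addVar_unwanted (hT : IsRTT c T) {J : Finset κ} {x z : ℂ} {U : Finset ℂ} :
    addVar c T x (fun y => ∏ l ∈ J, f c (v l) y) (unwanted c T v J z) U =
      ∑ ρ ∈ J, (unwantedCoeff c v J ρ * g c (v ρ) z * ∏ y ∈ U, f c (v ρ) y) •
        (addVar c T x (fun y => ∏ l ∈ J.erase ρ, f c (v l) y) (offShell c T v (J.erase ρ)) U *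
          T 1 1 (v ρ)) := by
  have h1 : ∀ y ∈ U, (g c x y * (∏ y' ∈ U.erase y, f c y y') * ∏ l ∈ J, f c (v l) y) •
      (T 0 2 x * unwanted c T v J z (U.erase y) * T 1 1 y) =
      ∑ ρ ∈ J, (unwantedCoeff c v J ρ * g c (v ρ) z * ∏ y ∈ U, f c (v ρ) y) •
        ((g c x y * (∏ y' ∈ U.erase y, f c y y') * ∏ l ∈ J.erase ρ, f c (v l) y) •
          (T 0 2 x * offShell c T v (J.erase ρ) (U.erase y) * T 1 1 y) * T 1 1 (v ρ)) := by
    intro y hy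
    rw [unwanted, mul_sum, sum_mul, smul_sum]
    refine sum_congr rfl fun ρ hρ => ?_
    rw [← mul_prod_erase J (fun l => f c (v l) y) hρ, ← mul_prod_erase U (fun y => f c (v ρ) y) hy]
    simp only [smul_mul_assoc, mul_smul_comm, smul_smul, mul_assoc]
    rw [(hT.commute_same (i := 1) (j := 1) (by decide) (by decide) (v ρ) y).eq]
    congr 1
    ring
  rw [addVar, sum_congr rfl h1, sum_comm, unwanted, mul_sum, ← sum_add_distrib]
  refine sum_congr rfl fun ρ _ => ?_
  rw [addVar, add_mul, smul_add, sum_mul, smul_sum, mul_smul_comm, mul_assoc (T 1 2 x)]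

theorem g_h_g_sub {c x z w : ℂ} (hc : c ≠ 0) (hxz : x ≠ z) (hwz : w ≠ z) (hwx : w ≠ x) :
    g c x z * h c z x * g c w z - g c x z * g c w x = -f c w x * g c w z := by
  rw [g_mul_h_swap hc hxz.symm]
  have := sub_ne_zero.2 hxz
  have := sub_ne_zero.2 hwz
  have := sub_ne_zero.2 hwx
  unfold f g
  field_simp
  ring

/-- The bare `G(U) T_{22}(x)` term of `addVarUnwanted` is the new summand `ρ = j`. For `ρ` in `J`
the contributions at `z` and at `v_j` merge by `g_h_g_sub` into the factor `-f(v_ρ, v_j)`; this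
explains the signs in `unwantedCoeff`. -/
theorem IsRTT.unwanted_insert_min (hT : IsRTT c T) (hc : c ≠ 0) (hv : Function.Injective v) {J : Finset κ} {j : κ}
    (hj : ∀ l ∈ J, j < l) {z : ℂ} {U : Finset ℂ} (hz : ∀ l ∈ insert j J, v l ≠ z) :
    unwanted c T v (insert j J) z U =
      addVarUnwanted c T (v j) (fun y => ∏ l ∈ J, f c (v l) y) (offShell c T v J)
        (unwanted c T v J) z U := by
  have hjJ : j ∉ J := fun hm => (hj j hm).false
  have h1 : unwantedCoeff c v (insert j J) j = ∏ l ∈ J, f c (v l) (v j) := by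
    rw [unwantedCoeff, erase_insert hjJ]
    exact prod_congr rfl fun l hl => if_pos (hj l hl)
  have h2 : ∑ ρ ∈ J, (unwantedCoeff c v (insert j J) ρ * g c (v ρ) z * ∏ y ∈ U, f c (v ρ) y) •
      (offShell c T v ((insert j J).erase ρ) U * T 1 1 (v ρ)) =
      (g c (v j) z * h c z (v j)) •
        addVar c T (v j) (fun y => ∏ l ∈ J, f c (v l) y) (unwanted c T v J z) U -
      g c (v j) z •
        addVar c T (v j) (fun y => ∏ l ∈ J, f c (v l) y) (unwanted c T v J (v j)) U := by
    rw [hT.addVar_unwanted, hT.addVar_unwanted, smul_sum, smul_sum, ← sum_sub_distrib]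
    refine sum_congr rfl fun ρ hρ => ?_
    have hjρ : j ≠ ρ := (hj ρ hρ).ne
    have hjJ' : j ∉ J.erase ρ := fun h' => hjJ (mem_of_mem_erase h')
    have h3 : unwantedCoeff c v (insert j J) ρ = -f c (v ρ) (v j) * unwantedCoeff c v J ρ := by
      rw [unwantedCoeff, erase_insert_of_ne hjρ, prod_insert hjJ', if_neg (hj ρ hρ).not_gt,
        unwantedCoeff]
    rw [h3, erase_insert_of_ne hjρ,
      offShell_insert_min (fun l hl => hj l (mem_of_mem_erase hl)), smul_smul, smul_smul,
      ← sub_smul]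
    congr 1
    linear_combination -(unwantedCoeff c v J ρ * ∏ y ∈ U, f c (v ρ) y) *
      g_h_g_sub hc (hz j (mem_insert_self _ _)) (hz ρ (mem_insert_of_mem hρ)) (hv.ne hjρ.symm)
  rw [unwanted, sum_insert hjJ, h2, h1, erase_insert hjJ, addVarUnwanted]
  module

/-- The action of `T_{12}(z)` and `T_{22}(z)` on off-shell vectors. -/
theorem IsRTT.act_offShell (hT : IsRTT c T) (hc : c ≠ 0) (hv : Function.Injective v)
    (J : Finset κ) (z : ℂ) (U : Finset ℂ) (hz : z ∉ U) (hJz : ∀ l ∈ J, v l ≠ z)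
    (hJU : ∀ l ∈ J, v l ∉ U) :
    ActT01 T (offShell c T v J) (unwanted c T v J) z U ∧
      ActT11 c T (fun y => ∏ l ∈ J, f c (v l) y) (offShell c T v J) (unwanted c T v J) z U := by
  induction J using Finset.induction_on_min generalizing z U with
  | empty =>
    have h1 : unwanted c T v ∅ = 0 := by
      funext z U
      simp [unwanted]
    rw [offShell_empty, h1]
    exact ⟨hT.actT01_opSet hz, hT.actT11_opSet hz⟩
  | insert j J hj ih =>
    have hjJ : j ∉ J := fun hm => (hj j hm).false
    have hjz := hJz j (mem_insert_self _ _)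
    have hjU := hJU j (mem_insert_self _ _)
    have hsub : ∀ {w y : ℂ}, w ∉ U → w ∉ U.erase y := fun hw h' => hw (mem_of_mem_erase h')
    have ihz := ih z U hz (fun l hl => hJz l (mem_insert_of_mem hl))
      (fun l hl => hJU l (mem_insert_of_mem hl))
    have ihz' : ∀ y ∈ U, _ := fun y _ => ih z (U.erase y) (hsub hz)
      (fun l hl => hJz l (mem_insert_of_mem hl))
      (fun l hl => hsub (hJU l (mem_insert_of_mem hl)))
    have ihx := ih (v j) U hjU (fun l hl => hv.ne (hj l hl).ne')
      (fun l hl => hJU l (mem_insert_of_mem hl))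
    have ihx' : ∀ y ∈ U, _ := fun y _ => ih (v j) (U.erase y) (hsub hjU)
      (fun l hl => hv.ne (hj l hl).ne')
      (fun l hl => hsub (hJU l (mem_insert_of_mem hl)))
    have h1 := hT.actT01_addVar hc hjz hjU hz ihz.1 (fun y hy => (ihz' y hy).1)
      (fun y hy => (ihx' y hy).1) ihz.2 ihx.2
    have h2 := hT.actT11_addVar hc hjz hjU hz (fun y hy => (ihz' y hy).1)
      (fun y hy => (ihx' y hy).1) ihz.2 (fun y hy => (ihz' y hy).2) ihx.2
    have h3 : (fun y => ∏ l ∈ insert j J, f c (v l) y) =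
        fun y => f c (v j) y * ∏ l ∈ J, f c (v l) y := funext fun y => prod_insert hjJ
    rw [ActT01, ← hT.unwanted_insert_min hc hv hj hJz] at h1
    rw [ActT11, ← hT.unwanted_insert_min hc hv hj hJz] at h2
    rw [h3, ActT01, ActT11, offShell_insert_min hj]
    exact ⟨h1, h2⟩

variable {ι : Type*} [LinearOrder ι]

/-- The operator `Y` is the normalized off-shell vector. -/
theorem symNorm_smul_Y (hT : IsRTT c T) (hc : c ≠ 0) {u : ι → ℂ} (hu : Function.Injective u)
    (hv : Function.Injective v) (huv : ∀ i j, u i ≠ v j)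
    (hvv : ∀ j k, j ≠ k → h c (v j) (v k) ≠ 0) (hvu : ∀ j i, h c (v j) (u i) ≠ 0)
    (I : Finset ι) (J : Finset κ) :
    symNorm c v J • Y c T u v I J = offShell c T v J (I.image u) := by
  induction J using Finset.induction_on_min generalizing I with
  | empty =>
    rw [Y_empty_right, offShell_empty, opProd_eq_opSet _ (hT.commute_same (by decide) (by decide)) hu]
    simp [symNorm]
  | insert j J hj ih =>
    have hjJ : j ∉ J := fun hm => (hj j hm).false
    have h1 : symNorm c v (insert j J) = symNorm c v J * ∏ l ∈ J, h c (v l) (v j) := by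
      rw [symNorm_insert c v hjJ, mul_comm]
      congr 1
      exact prod_congr rfl fun l hl => if_pos (hj l hl)
    rw [h1, mul_smul, Y_insert_min hc hT u v hu hv huv hvv hvu I J j hj, offShell_insert_min hj,
      addVar, sum_image hu.injOn, smul_add, ← mul_smul_comm, ih, smul_sum]
    congr 1
    refine sum_congr rfl fun i _ => ?_
    rw [← image_erase hu, prod_image hu.injOn, ← ih, smul_comm, mul_smul_comm, smul_mul_assoc]

/-- By `f = g h`, both branches of the order-dependent coefficient equal `g(v_l, v_ρ)` times the
factor `h` by which `symNorm` grows when `ρ` is inserted. -/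
theorem unwantedCoeff_mul_symNorm (hc : c ≠ 0) (hv : Function.Injective v) {J : Finset κ} {ρ : κ}
    (hρ : ρ ∈ J) : unwantedCoeff c v J ρ * symNorm c v (J.erase ρ) =
      (∏ l ∈ J.erase ρ, g c (v l) (v ρ)) * symNorm c v J := by
  conv_rhs => rw [← insert_erase hρ, symNorm_insert c v (notMem_erase ρ J), insert_erase hρ]
  rw [← mul_assoc, ← prod_mul_distrib, unwantedCoeff]
  congr 1
  refine prod_congr rfl fun l hl => ?_
  have hlρ := hv.ne (ne_of_mem_erase hl)
  split_ifs
  · exact f_eq_g_mul_h hc hlρ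
  · rw [f_eq_g_mul_h hc hlρ.symm, g_swap c (v ρ) (v l)]
    ring

end OffShell

end

end GL21

/-! ### The recursion in the variables `u` -/

theorem proposition2 {A : Type*} [Ring A] [Algebra ℂ A] (c : ℂ) (hc : c ≠ 0)
    (T : Fin 3 → Fin 3 → ℂ → A) (hT : GL21.IsRTT c T)
    (a b : ℕ) (u : Fin (a + 1) → ℂ) (v : Fin b → ℂ)
    (hu : Function.Injective u) (hv : Function.Injective v)
    (huv : ∀ i j, u i ≠ v j)
    (hvv : ∀ j k, j ≠ k → GL21.h c (v j) (v k) ≠ 0)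
    (hvu : ∀ j i, GL21.h c (v j) (u i) ≠ 0) :
    GL21.Y c T u v Finset.univ Finset.univ =
      T 0 1 (u (Fin.last a)) *
          GL21.Y c T u v (Finset.univ.erase (Fin.last a)) Finset.univ +
        ∑ ρ : Fin b,
          (GL21.g c (v ρ) (u (Fin.last a)) *
            (∏ i ∈ Finset.univ.erase (Fin.last a), GL21.f c (v ρ) (u i)) *
            (∏ j ∈ Finset.univ.erase ρ, GL21.g c (v j) (v ρ))) •
            (T 0 2 (u (Fin.last a)) *
              GL21.Y c T u v (Finset.univ.erase (Fin.last a)) (Finset.univ.erase ρ) *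
              T 1 1 (v ρ)) := by
  have hY := GL21.symNorm_smul_Y hT hc hu hv huv hvv hvu
  set z := u (Fin.last a) with hz
  set U := (Finset.univ.erase (Fin.last a)).image u with hU
  have hzU : z ∉ U := by
    rw [hU, Finset.image_erase hu]
    exact Finset.notMem_erase _ _
  have hins : insert z U = Finset.univ.image u := by
    rw [hU, Finset.image_erase hu]
    exact Finset.insert_erase (Finset.mem_image_of_mem _ (Finset.mem_univ _))
  have key := (hT.act_offShell hc hv Finset.univ z U hzU (fun l _ => (huv _ l).symm) (by
    intro l _ hm
    obtain ⟨i, -, hi⟩ := Finset.mem_image.1 hm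
    exact huv i l hi)).1
  rw [GL21.ActT01, hins, ← hY, hU, ← hY, GL21.unwanted] at key
  -- The action formula concerns the unnormalized vectors, so the identity is proved after
  -- multiplication by the nonzero `symNorm` and compared term by term in `ρ`.
  refine smul_right_injective A (GL21.symNorm_ne_zero c v hvv Finset.univ) ?_
  dsimp only
  rw [smul_add, ← mul_smul_comm, key, Finset.mul_sum, Finset.smul_sum, sub_add, eq_comm,
    sub_eq_self, sub_eq_zero]
  refine Finset.sum_congr rfl fun ρ _ => ?_
  have hρ := GL21.unwantedCoeff_mul_symNorm hc hv (Finset.mem_univ ρ)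
  rw [← hY, Finset.prod_image hu.injOn, smul_mul_assoc, smul_smul, mul_smul_comm, smul_smul,
    mul_assoc (T 0 2 z)]
  congr 1
  linear_combination GL21.g c (v ρ) z *
    (∏ i ∈ Finset.univ.erase (Fin.last a), GL21.f c (v ρ) (u i)) * hρ
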